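/- Let $\mathcal{H}$ be a complex Hilbert space and let $(\mathcal{A},\mathcal{H},D)$ be a spectral triple: $\mathcal{A}$ is a (real or complex) unital $*$-subalgebra of $B(\mathcal{H})$, $D$ is a self-adjoint operator on $\mathcal{H}$ with compact resolvent, and every $a\in\mathcal{A}$ preserves $\operatorname{dom} D$ with $[D,a]$ bounded. Write $\mathcal{H}^\infty=\bigcap_k \operatorname{dom} D^k$, and let $\delta(T)=[|D|,T]$, where $T\in\operatorname{dom}\delta$ means that $T\in B(\mathcal{H})$ preserves $\operatorname{dom}|D|$ and that $[|D|,T]$ extends to a bounded operator. Assume that the triple is strongly regular, that is, $$\mathcal{A}+[D,\mathcal{A}]\subset\bigcap_k\operatorname{dom}\delta^k\quad\text{and}\quad \operatorname{End}_{\mathcal{A}}(\mathcal{H}^\infty)\subset\bigcap_k\operatorname{dom}\delta^k,$$ where the second inclusion means that every $\mathbb{C}$-linear endomorphism of the $\mathcal{A}$-module $\mathcal{H}^\infty$ extends to a bounded operator on $\mathcal{H}$ lying in every $\operatorname{dom}\delta^k$. Assume also that it has metric dimension $p$ for an integer $p\ge 1$, that is, the eigenvalues of $(D^2+1)^{-1}$,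 in decreasing order and counted with multiplicity, are $O(k^{-2/p})$ as $k\to\infty$. Let $M\in B(\mathcal{H})$ be self-adjoint and belong to $\operatorname{End}_{\mathcal{A}}(\mathcal{H}^\infty)$ (that is, $M$ restricts to an endomorphism of the $\mathcal{A}$-module $\mathcal{H}^\infty$), and let $D_M=D+M$ with domain $\operatorname{dom} D$. Let $|D|^{-p}$ and $|D_M|^{-p}$ be defined by functional calculus, as $0$ on the kernels of $D$ and $D_M$ respectively. Then $|D_M|^{-p}-|D|^{-p}$ is trace class. Moreover, for every $T\in B(\mathcal{H})$, the operators $T|D|^{-p}$ and $T|D_M|^{-p}$ belong to the Dixmier ideal $\mathcal{L}^{1+}(\mathcal{H})$, and for every Dixmier trace $\operatorname{Tr}_\omega$ $$\operatorname{Tr}_\omega\bigl(T|D|^{-p}\bigr)=\operatorname{Tr}_\omega\bigl(T|D_M|^{-p}\bigr).$$ Here, for a bounded operator $S$ and $r\ge 0$, $\sigma_r(S)$ denotes the sum of the first $r$ singular values of $S$, interpolated linearly between integers $r$; $\mathcal{L}^{1+}(\mathcal{H})$ consists of the $S$ such that $\sigma_r(S)/\log r$ is bounded on $[e,\infty)$;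 $\omega$ ranges over all states on the bounded continuous functions on $[e,\infty)$ that vanish on functions tending to $0$ at infinity and satisfy $\omega(f(a\,\cdot))=\omega(f)$ for all $a\ge1$; and $\operatorname{Tr}_\omega$ is the linear functional on $\mathcal{L}^{1+}(\mathcal{H})$ with $\operatorname{Tr}_\omega(S)=\omega\bigl(r\mapsto\sigma_r(S)/\log r\bigr)$ for $S\ge0$. -/

import Mathlib

open scoped Topology BoundedContinuousFunction ComplexStarModule

noncomputable section

namespace SpectralTriple

variable {H : Type*} [NormedAddCommGroup H] [InnerProductSpace ℂ H] [CompleteSpace H]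

/-! ### Singular values, trace class operators, Dixmier traces -/

/-- The `n`-th singular value (characteristic value) of a bounded operator, `n = 0, 1, 2, …`: the
distance from `T` to the operators of rank at most `n`. For compact `T` these are the eigenvalues of
`|T|` in decreasing order, counted with multiplicity (and `0` once these are exhausted). -/
def singularValue (T : H →L[ℂ] H) (n : ℕ) : ℝ :=
  sInf {r : ℝ | ∃ R : H →L[ℂ] H, LinearMap.rank (R : H →ₗ[ℂ] H) ≤ n ∧ r = ‖T - R‖}

/-- The trace class `ℒ¹(H)`: the singular values are summable. -/
def IsTraceClass (T : H →L[ℂ] H) : Prop :=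
  Summable (singularValue T)

/-- `σ_r(T)`: the sum of the first `r` singular values for `r ∈ ℕ`, interpolated linearly between
consecutive integers. -/
def partialSum (T : H →L[ℂ] H) (r : ℝ) : ℝ :=
  ∑ k ∈ Finset.range ⌊r⌋₊, singularValue T k + (r - ⌊r⌋₊) * singularValue T ⌊r⌋₊

/-- The Dixmier ideal `ℒ^{1+}(H)`: `σ_r(T) / log r` is bounded for `r ≥ e`. (Such a `T` is
automatically compact.) -/
def MemDixmierIdeal (T : H →L[ℂ] H) : Prop :=
  ∃ C : ℝ, ∀ r : ℝ, Real.exp 1 ≤ r → partialSum T r ≤ C * Real.log r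

/-- A dilation invariant extended limit: a state on the bounded continuous functions on `[e, ∞)`
which vanishes on the functions tending to `0` at infinity and does not distinguish `f` from
`x ↦ f (a x)` for `a ≥ 1`. If `ω₀` is any state vanishing at infinity and `C` the logarithmic Cesàro
mean `(C f)(x) = (1 / log x) ∫_e^x f(t) dt / t`, then `ω₀ ∘ C` is such a functional. -/
structure ExtendedLimit where
  /-- the underlying functional -/
  toLinearMap : (Set.Ici (Real.exp 1) →ᵇ ℝ) →ₗ[ℝ] ℝ
  map_nonneg : ∀ f : Set.Ici (Real.exp 1) →ᵇ ℝ, (∀ x, 0 ≤ f x) → 0 ≤ toLinearMap f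
  map_one : toLinearMap (BoundedContinuousFunction.const _ 1) = 1
  map_of_tendsto_zero : ∀ f : Set.Ici (Real.exp 1) →ᵇ ℝ,
    Filter.Tendsto f Filter.atTop (𝓝 0) → toLinearMap f = 0
  map_dilation : ∀ a : ℝ, 1 ≤ a → ∀ f g : Set.Ici (Real.exp 1) →ᵇ ℝ,
    (∀ x y : Set.Ici (Real.exp 1), (y : ℝ) = a * x → g x = f y) → toLinearMap g = toLinearMap f

open Classical in
/-- The value `ω(r ↦ σ_r(T) / log r)` of the Dixmier trace on a positive `T ∈ ℒ^{1+}(H)`; for such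
`T` the function is bounded and continuous on `[e, ∞)`. -/
def dixmierTracePos (ω : ExtendedLimit) (T : H →L[ℂ] H) : ℝ :=
  if h : ∃ f : Set.Ici (Real.exp 1) →ᵇ ℝ, ∀ r, f r = partialSum T r / Real.log r then
    ω.toLinearMap h.choose
  else 0

/-- The Dixmier trace `Tr_ω`, extended from positive operators to `ℒ^{1+}(H)` along the decomposition
`T = (Re T)⁺ - (Re T)⁻ + i ((Im T)⁺ - (Im T)⁻)`. -/
def dixmierTrace (ω : ExtendedLimit) (T : H →L[ℂ] H) : ℂ :=
  ((dixmierTracePos ω (ℜ T : H →L[ℂ] H)⁺ - dixmierTracePos ω (ℜ T : H →L[ℂ] H)⁻ : ℝ) : ℂ) +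
    Complex.I *
      ((dixmierTracePos ω (ℑ T : H →L[ℂ] H)⁺ - dixmierTracePos ω (ℑ T : H →L[ℂ] H)⁻ : ℝ) : ℂ)

/-! ### Functional calculus of a self-adjoint operator with compact resolvent -/

/-- `R` is the resolvent `(D - z)⁻¹`. -/
def IsResolvent (D : H →ₗ.[ℂ] H) (z : ℂ) (R : H →L[ℂ] H) : Prop :=
  (∀ y : H, ∃ h : R y ∈ D.domain, D ⟨R y, h⟩ - z • R y = y) ∧
    ∀ x : D.domain, R (D x - z • (x : H)) = x

/-- `(D - z)⁻¹` exists as a compact operator for every non-real `z`. -/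
def HasCompactResolvent (D : H →ₗ.[ℂ] H) : Prop :=
  ∀ z : ℂ, z.im ≠ 0 → ∃ R : H →L[ℂ] H, IsResolvent D z R ∧ IsCompactOperator R

/-- The eigenspace `{x ∈ dom D | D x = t x}` for a real number `t`. -/
def eigenspace (D : H →ₗ.[ℂ] H) (t : ℝ) : Submodule ℂ H :=
  D.graph.comap (LinearMap.prod LinearMap.id ((t : ℂ) • LinearMap.id))

/-- The orthogonal projection `P_t` onto the eigenspace for `t`. (The eigenspace of a closed operator
is closed; the closure is written only to have the projection for every `D`.) -/
def spectralProj (D : H →ₗ.[ℂ] H) (t : ℝ) : H →L[ℂ] H :=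
  (eigenspace D t).topologicalClosure.starProjection

/-- `f(D) x = ∑_t f(t) P_t x`, on the domain of all `x` for which this orthogonal series converges
(that is, `∑_t |f(t)|² ‖P_t x‖² < ∞`). For `D` self-adjoint with compact resolvent, `H` is the Hilbert
sum of the eigenspaces, and this is the Borel functional calculus. -/
def funcCalc (D : H →ₗ.[ℂ] H) (f : ℝ → ℝ) : H →ₗ.[ℂ] H where
  domain :=
    { carrier := {x | Summable fun t : ℝ => (f t : ℂ) • spectralProj D t x}
      zero_mem' := by simp [summable_zero]
      add_mem' := fun {x y} hx hy => by
        have h := Summable.add (show Summable _ from hx) (show Summable _ from hy)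
        simpa only [Set.mem_ofPred_eq, map_add, smul_add] using h
      smul_mem' := fun c x hx => by
        have h := Summable.const_smul c (show Summable _ from hx)
        simpa only [Set.mem_ofPred_eq, map_smul, smul_comm c] using h }
  toFun :=
    { toFun := fun x => ∑' t : ℝ, (f t : ℂ) • spectralProj D t (x : H)
      map_add' := fun x y => by
        have h := Summable.tsum_add (show Summable _ from x.2) (show Summable _ from y.2)
        simpa only [Submodule.coe_add, map_add, smul_add] using h
      map_smul' := fun c x => by
        have h := Summable.tsum_const_smul c (show Summable _ from x.2)
        simpa only [Submodule.coe_smul, map_smul, smul_comm c, RingHom.id_apply] using h }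

/-- The absolute value `|D|`. -/
def absOp (D : H →ₗ.[ℂ] H) : H →ₗ.[ℂ] H :=
  funcCalc D fun t => |t|

/-- `f(D) = ∑_t f(t) P_t` as a bounded operator, for `f` tending to `0` along the eigenvalues of `D`;
the sum then converges in operator norm. -/
def funcCalcBdd (D : H →ₗ.[ℂ] H) (f : ℝ → ℝ) : H →L[ℂ] H :=
  ∑' t : ℝ, (f t : ℂ) • spectralProj D t

/-- `|D|^{-p}` for `p ≥ 1`, taken to be `0` on the kernel of `D`. -/
def absInvPow (D : H →ₗ.[ℂ] H) (p : ℕ) : H →L[ℂ] H :=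
  funcCalcBdd D fun t => (|t|⁻¹) ^ p

/-! ### Spectral triples -/

/-- `T` preserves the domain of `A`, and the commutator `[A, T]`, defined there, extends to the
bounded operator `T'`. -/
def IsCommutator (A : H →ₗ.[ℂ] H) (T T' : H →L[ℂ] H) : Prop :=
  ∀ x : A.domain, ∃ h : T x ∈ A.domain, A ⟨T x, h⟩ - T (A x) = T' x

/-- `(𝒜, H, D)` is a spectral triple: `𝒜` is a (real or complex) unital `*`-algebra of bounded
operators on the Hilbert space `H`, `D` is self-adjoint with compact resolvent, and `[D, a]` is
bounded for all `a ∈ 𝒜`. -/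
structure IsSpectralTriple (𝒜 : StarSubalgebra ℝ (H →L[ℂ] H)) (D : H →ₗ.[ℂ] H) : Prop where
  isSelfAdjoint : IsSelfAdjoint D
  hasCompactResolvent : HasCompactResolvent D
  bounded_commutator : ∀ a ∈ 𝒜, ∃ T', IsCommutator D a T'

/-- Metric dimension `p`: the eigenvalues of `(D² + 1)⁻¹`, in decreasing order, are
`O(k^{-2/p})`. -/
def HasMetricDimension (D : H →ₗ.[ℂ] H) (p : ℕ) : Prop :=
  (fun k : ℕ => singularValue (funcCalcBdd D fun t => (t ^ 2 + 1)⁻¹) k)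
    =O[Filter.atTop] fun k : ℕ => (k : ℝ) ^ (-(2 / (p : ℝ)))

/-- The domain of `D^k`. -/
def domPow (D : H →ₗ.[ℂ] H) : ℕ → Submodule ℂ H
  | 0 => ⊤
  | k + 1 => (D.graph ⊓ (domPow D k).comap (LinearMap.snd ℂ H H)).map (LinearMap.fst ℂ H H)

/-- `H^∞ = ⋂_k dom D^k`. -/
def smoothDomain (D : H →ₗ.[ℂ] H) : Submodule ℂ H :=
  ⨅ k, domPow D k

/-- The domain of `δ^k`, for the derivation `δ(T) = [|D|, T]` on `B(H)`. -/
def domDelta (D : H →ₗ.[ℂ] H) : ℕ → Set (H →L[ℂ] H)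
  | 0 => Set.univ
  | k + 1 => {T | ∃ T', IsCommutator (absOp D) T T' ∧ T' ∈ domDelta D k}

/-- `S` is an endomorphism of the `𝒜`-module `H^∞`. -/
def IsModuleEnd (𝒜 : StarSubalgebra ℝ (H →L[ℂ] H)) (D : H →ₗ.[ℂ] H)
    (S : smoothDomain D →ₗ[ℂ] smoothDomain D) : Prop :=
  ∀ a ∈ 𝒜, ∀ x y : smoothDomain D, (y : H) = a (x : H) → (S y : H) = a (S x : H)

/-- Regularity: `𝒜 + [D, 𝒜] ⊆ ⋂_k dom δ^k`. -/
def IsRegular (𝒜 : StarSubalgebra ℝ (H →L[ℂ] H)) (D : H →ₗ.[ℂ] H) : Prop :=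
  ∀ a ∈ 𝒜, (∀ k, a ∈ domDelta D k) ∧ ∀ T', IsCommutator D a T' → ∀ k, T' ∈ domDelta D k

/-- The bounded operator `T` restricts to the linear map `S` on `H^∞`. -/
def Extends (D : H →ₗ.[ℂ] H) (T : H →L[ℂ] H) (S : smoothDomain D →ₗ[ℂ] smoothDomain D) : Prop :=
  ∀ x : smoothDomain D, T x = S x

/-- Strong regularity: regularity, and `End_𝒜(H^∞) ⊆ ⋂_k dom δ^k`, that is, every endomorphism of
the `𝒜`-module `H^∞` extends to a bounded operator on `H` in the domain of every `δ^k`. -/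
def IsStronglyRegular (𝒜 : StarSubalgebra ℝ (H →L[ℂ] H)) (D : H →ₗ.[ℂ] H) : Prop :=
  IsRegular 𝒜 D ∧ ∀ S : smoothDomain D →ₗ[ℂ] smoothDomain D, IsModuleEnd 𝒜 D S →
    ∃ T : H →L[ℂ] H, Extends D T S ∧ ∀ k, T ∈ domDelta D k

/-- The bounded operator `M` belongs to `End_𝒜(H^∞)`: it restricts to an endomorphism of the
`𝒜`-module `H^∞`. -/
def MemModuleEnd (𝒜 : StarSubalgebra ℝ (H →L[ℂ] H)) (D : H →ₗ.[ℂ] H) (M : H →L[ℂ] H) : Prop :=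
  ∃ S : smoothDomain D →ₗ[ℂ] smoothDomain D, IsModuleEnd 𝒜 D S ∧ Extends D M S

/-- The perturbed operator `D + M`, with domain `dom D`. -/
def perturb (D : H →ₗ.[ℂ] H) (M : H →L[ℂ] H) : H →ₗ.[ℂ] H :=
  (M : H →ₗ[ℂ] H) +ᵥ D

end SpectralTriple

end

open scoped Topology BoundedContinuousFunction ComplexStarModule
set_option linter.unusedSectionVars false

namespace SpectralTriple
open ContinuousLinearMap

/-! ### Singular values and the classes `s_n = O(n ^ (-a))` -/

section SingularValues

variable {H : Type*} [NormedAddCommGroup H] [InnerProductSpace ℂ H] [CompleteSpace H]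

/-! Put `a = 1 / p`. Metric dimension `p` says that `|D|⁻¹` lies in the class of operators with `s_n
= O(n ^ (-a))`. These classes behave well under sums, and exponents add under products. The heart of
the proof is that `|D_M|⁻¹ - |D|⁻¹` gains a full factor and has `s_n = O(n ^ (-2a))`
(`weakClass_diag_abs_inv_sub`). Telescoping `p`-th powers (`WeakClass.pow_sub_pow`) then gives `s_n
= O(n ^ (-1 - a))` for `|D_M|^{-p} - |D|^{-p}`, which is summable.

For the gain, write `G`, `F` for the inverse and the sign of `D`, and `G'`, `F'` for those of `D_M`.
Then `F'G' - FG = F'(G' - G) + (F' - F)G`. The resolvent identity makes `G' - G` equal to `-G'MG` up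
to finite rank. The term `(F' - F)G` only sees eigenvectors of `D` and `D_M` whose eigenvalues have
opposite signs, or lie in the kernel of `D_M`. A Davis–Kahan type estimate
(`norm_basisProj_mul_basisProj_le`) bounds the overlap of the positive subspace of `D_M` with the
subspace `D ≤ -t` by `‖M‖ / t`, and `G` supplies another factor `1 / t`.

For the Dixmier traces, adding an operator of class `a > 1` changes the partial sums of singular
values of each positive and negative part of the real and imaginary parts by a bounded amount
(`sum_singularValue_posPart_add_le`, from Ky Fan's inequality). Divided by `log r` this tends to
`0`, so the extended limit ignores it.

To work with matrix coefficients instead of unbounded operators, both `D` and `D_M` are diagonalised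
in Hilbert bases (`exists_isEigenbasis`). Their relation becomes `Intertwines`, and the functional
calculus becomes `diag`. -/

theorem bddBelow_approximations (T : H →L[ℂ] H) (n : ℕ) :
    BddBelow {r : ℝ | ∃ R : H →L[ℂ] H, LinearMap.rank (R : H →ₗ[ℂ] H) ≤ n ∧ r = ‖T - R‖} :=
  ⟨0, by rintro r ⟨R, _, rfl⟩; exact norm_nonneg _⟩

theorem nonempty_approximations (T : H →L[ℂ] H) (n : ℕ) :
    {r : ℝ | ∃ R : H →L[ℂ] H, LinearMap.rank (R : H →ₗ[ℂ] H) ≤ n ∧ r = ‖T - R‖}.Nonempty :=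
  ⟨_, 0, by simp, rfl⟩

theorem singularValue_nonneg (T : H →L[ℂ] H) (n : ℕ) : 0 ≤ singularValue T n :=
  Real.sInf_nonneg (by rintro r ⟨R, _, rfl⟩; exact norm_nonneg _)

theorem singularValue_le {T R : H →L[ℂ] H} {n : ℕ}
    (hR : LinearMap.rank (R : H →ₗ[ℂ] H) ≤ n) : singularValue T n ≤ ‖T - R‖ :=
  csInf_le (bddBelow_approximations T n) ⟨R, hR, rfl⟩

theorem exists_norm_sub_lt (T : H →L[ℂ] H) (n : ℕ) {ε : ℝ} (hε : 0 < ε) :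
    ∃ R : H →L[ℂ] H, LinearMap.rank (R : H →ₗ[ℂ] H) ≤ n ∧ ‖T - R‖ < singularValue T n + ε := by
  obtain ⟨_, ⟨R, hR, rfl⟩, h⟩ := Real.lt_sInf_add_pos (nonempty_approximations T n) hε
  exact ⟨R, hR, h⟩

theorem le_singularValue {T : H →L[ℂ] H} {n : ℕ} {c : ℝ}
    (h : ∀ R : H →L[ℂ] H, LinearMap.rank (R : H →ₗ[ℂ] H) ≤ n → c ≤ ‖T - R‖) :
    c ≤ singularValue T n :=
  le_csInf (nonempty_approximations T n) (by rintro r ⟨R, hR, rfl⟩; exact h R hR)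

theorem singularValue_antitone (T : H →L[ℂ] H) : Antitone (singularValue T) :=
  fun _ _ hmn => le_singularValue fun _ hR => singularValue_le (hR.trans (mod_cast hmn))

theorem singularValue_le_norm (T : H →L[ℂ] H) (n : ℕ) : singularValue T n ≤ ‖T‖ := by
  simpa using singularValue_le (T := T) (R := 0) (n := n) (by simp)

theorem singularValue_eq_zero {T : H →L[ℂ] H} {n : ℕ}
    (h : LinearMap.rank (T : H →ₗ[ℂ] H) ≤ n) : singularValue T n = 0 :=
  le_antisymm (by simpa using singularValue_le (T := T) h) (singularValue_nonneg T n)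

theorem singularValue_add_le (S T : H →L[ℂ] H) (m n : ℕ) :
    singularValue (S + T) (m + n) ≤ singularValue S m + singularValue T n := by
  refine le_of_forall_pos_le_add fun ε hε => ?_
  obtain ⟨R, hR, h⟩ := exists_norm_sub_lt S m (half_pos hε)
  obtain ⟨R', hR', h'⟩ := exists_norm_sub_lt T n (half_pos hε)
  have hrank : LinearMap.rank ((R + R' : H →L[ℂ] H) : H →ₗ[ℂ] H) ≤ (m + n : ℕ) := by
    rw [ContinuousLinearMap.toLinearMap_add]
    exact (LinearMap.rank_add_le _ _).trans (by push_cast; exact add_le_add hR hR')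
  have h1 := singularValue_le (T := S + T) hrank
  have h2 : S + T - (R + R') = (S - R) + (T - R') := by abel
  rw [h2] at h1
  linarith [norm_add_le (S - R) (T - R')]

theorem singularValue_mul_le (S T : H →L[ℂ] H) (m n : ℕ) :
    singularValue (S * T) (m + n) ≤ singularValue S m * singularValue T n := by
  have key : ∀ ε : ℝ, 0 < ε →
      singularValue (S * T) (m + n) ≤ (singularValue S m + ε) * (singularValue T n + ε) := by
    intro ε hε
    obtain ⟨R, hR, h⟩ := exists_norm_sub_lt S m hε
    obtain ⟨R', hR', h'⟩ := exists_norm_sub_lt T n hε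
    -- This approximant of `S * T` is chosen so that the error factors as `(S - R) * (T - R')`.
    have hrank : LinearMap.rank ((R * (T - R') + S * R' : H →L[ℂ] H) : H →ₗ[ℂ] H)
        ≤ (m + n : ℕ) := by
      rw [ContinuousLinearMap.toLinearMap_add]
      refine (LinearMap.rank_add_le _ _).trans ?_
      push_cast
      exact add_le_add ((LinearMap.rank_comp_le_left _ _).trans hR)
        ((LinearMap.rank_comp_le_right _ _).trans hR')
    have h1 := singularValue_le (T := S * T) hrank
    have h2 : S * T - (R * (T - R') + S * R') = (S - R) * (T - R') := by noncomm_ring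
    rw [h2] at h1
    refine h1.trans ((norm_mul_le _ _).trans ?_)
    exact mul_le_mul h.le h'.le (norm_nonneg _) ((norm_nonneg _).trans h.le)
  have hlim : Filter.Tendsto
      (fun ε : ℝ => (singularValue S m + ε) * (singularValue T n + ε)) (𝓝[>] 0)
      (𝓝 ((singularValue S m + 0) * (singularValue T n + 0))) :=
    (Continuous.tendsto (by fun_prop) 0).mono_left nhdsWithin_le_nhds
  simpa using ge_of_tendsto hlim (Filter.eventually_of_mem self_mem_nhdsWithin key)

theorem singularValue_mul_le_left (A T : H →L[ℂ] H) (n : ℕ) :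
    singularValue (A * T) n ≤ ‖A‖ * singularValue T n := by
  have h := singularValue_mul_le A T 0 n
  rw [zero_add] at h
  exact h.trans (mul_le_mul_of_nonneg_right (singularValue_le_norm A 0) (singularValue_nonneg T n))

theorem singularValue_smul_le (c : ℂ) (T : H →L[ℂ] H) (n : ℕ) :
    singularValue (c • T) n ≤ ‖c‖ * singularValue T n := by
  have h := singularValue_mul_le_left (c • (1 : H →L[ℂ] H)) T n
  rw [smul_mul_assoc, one_mul] at h
  refine h.trans (mul_le_mul_of_nonneg_right ?_ (singularValue_nonneg T n))
  exact (norm_smul_le _ _).trans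
    (mul_le_of_le_one_right (norm_nonneg _) ContinuousLinearMap.norm_id_le)

theorem singularValue_neg (T : H →L[ℂ] H) (n : ℕ) : singularValue (-T) n = singularValue T n := by
  have h : ∀ S : H →L[ℂ] H, singularValue (-S) n ≤ singularValue S n := fun S => by
    simpa using singularValue_smul_le (-1) S n
  exact le_antisymm (h T) (by simpa using h (-T))

/-- If `P` projects onto the range of `R`, then `R = P R`. Hence `R* = R* P` factors through that
finite-dimensional space. -/
theorem rank_adjoint_le {R : H →L[ℂ] H} {n : ℕ} (h : LinearMap.rank (R : H →ₗ[ℂ] H) ≤ n) :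
    LinearMap.rank (adjoint R : H →ₗ[ℂ] H) ≤ n := by
  set V : Submodule ℂ H := LinearMap.range (R : H →ₗ[ℂ] H)
  have hV : FiniteDimensional ℂ V :=
    Module.rank_lt_aleph0_iff.mp (lt_of_le_of_lt h (Cardinal.natCast_lt_aleph0))
  have hPR : V.starProjection * R = R := by
    ext x
    exact Submodule.starProjection_eq_self_iff.mpr (LinearMap.mem_range_self _ x)
  have hadj : adjoint R = adjoint R * V.starProjection := by
    conv_lhs => rw [← hPR]
    change adjoint (V.starProjection.comp R) = _
    rw [ContinuousLinearMap.adjoint_comp]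
    congr 1
    exact (isSelfAdjoint_starProjection V).adjoint_eq
  rw [hadj]
  refine (LinearMap.rank_comp_le_right _ _).trans (le_trans ?_ h)
  refine Submodule.rank_mono ?_
  rintro _ ⟨x, rfl⟩
  exact Submodule.starProjection_apply_mem V x

theorem singularValue_adjoint_le (T : H →L[ℂ] H) (n : ℕ) :
    singularValue (adjoint T) n ≤ singularValue T n := by
  refine le_singularValue fun R hR => ?_
  have h := singularValue_le (T := adjoint T) (rank_adjoint_le hR)
  rwa [← map_sub, LinearIsometryEquiv.norm_map] at h

/-- Given `R` of rank at most `n`, approximate `A` by `A` composed with the projection onto the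
range of `R*`. The error lives on the orthogonal complement, where `R` vanishes and `B` coincides
with `B - R`. -/
theorem singularValue_le_of_norm_apply_le {A B : H →L[ℂ] H} (h : ∀ v, ‖A v‖ ≤ ‖B v‖) (n : ℕ) :
    singularValue A n ≤ singularValue B n := by
  refine le_singularValue fun R hR => ?_
  set V : Submodule ℂ H := LinearMap.range (adjoint R : H →ₗ[ℂ] H)
  have hrank : Module.rank ℂ V ≤ n := rank_adjoint_le hR
  have hV : FiniteDimensional ℂ V :=
    Module.rank_lt_aleph0_iff.mp (lt_of_le_of_lt hrank (Cardinal.natCast_lt_aleph0))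
  have hker : ∀ x, R (Vᗮ.starProjection x) = 0 := by
    intro x
    rw [← inner_self_eq_zero (𝕜 := ℂ), ← ContinuousLinearMap.adjoint_inner_right]
    exact Submodule.inner_left_of_mem_orthogonal (K := V) (LinearMap.mem_range_self _ _)
      (Submodule.starProjection_apply_mem _ x)
  have hr : LinearMap.rank ((A * V.starProjection : H →L[ℂ] H) : H →ₗ[ℂ] H) ≤ n := by
    refine (LinearMap.rank_comp_le_right _ _).trans (le_trans (Submodule.rank_mono ?_) hrank)
    rintro _ ⟨x, rfl⟩
    exact Submodule.starProjection_apply_mem V x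
  refine (singularValue_le hr).trans (ContinuousLinearMap.opNorm_le_bound _ (norm_nonneg _) ?_)
  intro x
  have h1 : (A - A * V.starProjection) x = A (Vᗮ.starProjection x) := by
    simp [Submodule.starProjection_orthogonal_val]
  rw [h1]
  calc ‖A (Vᗮ.starProjection x)‖ ≤ ‖B (Vᗮ.starProjection x)‖ := h _
    _ = ‖(B - R) (Vᗮ.starProjection x)‖ := by rw [_root_.sub_apply, hker, sub_zero]
    _ ≤ ‖B - R‖ * ‖Vᗮ.starProjection x‖ := le_opNorm _ _
    _ ≤ ‖B - R‖ * ‖x‖ := by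
      gcongr
      exact Submodule.norm_starProjection_apply_le _ x

/-- The lower half of the min-max principle: an operator of rank at most `n` kills a nonzero vector
of a space of dimension greater than `n`. -/
theorem le_singularValue_of_subspace {T : H →L[ℂ] H} {V : Submodule ℂ H} [FiniteDimensional ℂ V]
    {n : ℕ} (hn : n < Module.finrank ℂ V) {c : ℝ} (h : ∀ v ∈ V, c * ‖v‖ ≤ ‖T v‖) :
    c ≤ singularValue T n := by
  refine le_singularValue fun R hR => ?_
  have hinj : ¬ Function.Injective ((R : H →ₗ[ℂ] H).domRestrict V) := by
    intro hi
    have h1 := LinearMap.rank_comp_le_left V.subtype (R : H →ₗ[ℂ] H)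
    have h2 := h1.trans hR
    have h3 : LinearMap.rank ((R : H →ₗ[ℂ] H).comp V.subtype) = Module.rank ℂ V :=
      rank_range_of_injective _ hi
    rw [h3, ← Module.finrank_eq_rank] at h2
    exact absurd (by exact_mod_cast h2) (not_le.mpr hn)
  rw [← LinearMap.ker_eq_bot, Submodule.eq_bot_iff] at hinj
  push Not at hinj
  obtain ⟨v, hv, hv0⟩ := hinj
  have hRv : R (v : H) = 0 := hv
  have hpos : 0 < ‖(v : H)‖ := norm_pos_iff.mpr (by simpa using hv0)
  refine le_of_mul_le_mul_right ((h v v.2).trans ?_) hpos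
  simpa [hRv] using (T - R).le_opNorm v

/-- The class of operators with `s_n(T) = O(n ^ (-a))`. -/
def WeakClass (a : ℝ) (T : H →L[ℂ] H) : Prop :=
  ∃ C : ℝ, 0 ≤ C ∧ ∀ n : ℕ, singularValue T n ≤ C * ((n : ℝ) + 1) ^ (-a)

/-- The inequalities for sums and products spend the index twice. By monotonicity a bound at even
indices suffices, and halving the index costs the factor `2 ^ a`. -/
theorem weakClass_of_half {a : ℝ} (ha : 0 ≤ a) {T : H →L[ℂ] H} {C : ℝ} (hC : 0 ≤ C)
    (h : ∀ n : ℕ, singularValue T (n + n) ≤ C * ((n : ℝ) + 1) ^ (-a)) : WeakClass a T := by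
  refine ⟨C * 2 ^ a, by positivity, fun n => ?_⟩
  refine ((singularValue_antitone T (by lia : n / 2 + n / 2 ≤ n)).trans (h (n / 2))).trans ?_
  rw [mul_assoc]
  refine mul_le_mul_of_nonneg_left ?_ hC
  have h1 : ((n : ℝ) + 1) ≤ 2 * (((n / 2 : ℕ) : ℝ) + 1) := by
    have : n + 1 ≤ 2 * (n / 2 + 1) := by lia
    exact_mod_cast this
  have h2 : (2 : ℝ) ^ a * ((n : ℝ) + 1) ^ (-a) = (((n : ℝ) + 1) / 2) ^ (-a) := by
    rw [Real.div_rpow (by positivity) (by norm_num), Real.rpow_neg (by norm_num : (0 : ℝ) ≤ 2)]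
    field_simp
  rw [h2]
  exact Real.rpow_le_rpow_of_nonpos (by positivity) (by linarith) (by linarith)

theorem WeakClass.add {a : ℝ} (ha : 0 ≤ a) {S T : H →L[ℂ] H} (hS : WeakClass a S)
    (hT : WeakClass a T) : WeakClass a (S + T) := by
  obtain ⟨C, hC, h⟩ := hS
  obtain ⟨C', hC', h'⟩ := hT
  refine weakClass_of_half ha (add_nonneg hC hC') fun n => ?_
  refine (singularValue_add_le S T n n).trans ?_
  rw [add_mul]
  exact add_le_add (h n) (h' n)

theorem WeakClass.mul {a b : ℝ} (ha : 0 ≤ a) (hb : 0 ≤ b) {S T : H →L[ℂ] H} (hS : WeakClass a S)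
    (hT : WeakClass b T) : WeakClass (a + b) (S * T) := by
  obtain ⟨C, hC, h⟩ := hS
  obtain ⟨C', hC', h'⟩ := hT
  refine weakClass_of_half (add_nonneg ha hb) (mul_nonneg hC hC') fun n => ?_
  refine (singularValue_mul_le S T n n).trans ?_
  refine (mul_le_mul (h n) (h' n) (singularValue_nonneg _ _) (by positivity)).trans_eq ?_
  rw [neg_add, Real.rpow_add (by positivity)]
  ring

theorem WeakClass.mono {a b : ℝ} (hab : a ≤ b) {T : H →L[ℂ] H} (hT : WeakClass b T) :
    WeakClass a T := by
  obtain ⟨C, hC, h⟩ := hT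
  refine ⟨C, hC, fun n => (h n).trans (mul_le_mul_of_nonneg_left ?_ hC)⟩
  exact Real.rpow_le_rpow_of_exponent_le (by linarith [n.cast_nonneg (α := ℝ)]) (neg_le_neg hab)

theorem weakClass_zero (T : H →L[ℂ] H) : WeakClass 0 T :=
  ⟨‖T‖, norm_nonneg _, fun n => by simpa using singularValue_le_norm T n⟩

theorem WeakClass.mul_left {a : ℝ} (ha : 0 ≤ a) (A : H →L[ℂ] H) {T : H →L[ℂ] H}
    (hT : WeakClass a T) : WeakClass a (A * T) := by
  simpa using (weakClass_zero A).mul le_rfl ha hT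

theorem WeakClass.mul_right {a : ℝ} (ha : 0 ≤ a) {T : H →L[ℂ] H}
    (hT : WeakClass a T) (A : H →L[ℂ] H) : WeakClass a (T * A) := by
  simpa using hT.mul ha le_rfl (weakClass_zero A)

theorem WeakClass.neg {a : ℝ} {T : H →L[ℂ] H} (hT : WeakClass a T) : WeakClass a (-T) := by
  obtain ⟨C, hC, h⟩ := hT
  exact ⟨C, hC, fun n => by rw [singularValue_neg]; exact h n⟩

theorem WeakClass.sub {a : ℝ} (ha : 0 ≤ a) {S T : H →L[ℂ] H} (hS : WeakClass a S)
    (hT : WeakClass a T) : WeakClass a (S - T) := by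
  rw [sub_eq_add_neg]
  exact hS.add ha hT.neg

theorem WeakClass.smul {a : ℝ} (c : ℂ) {T : H →L[ℂ] H} (hT : WeakClass a T) :
    WeakClass a (c • T) := by
  obtain ⟨C, hC, h⟩ := hT
  refine ⟨‖c‖ * C, by positivity, fun n => (singularValue_smul_le c T n).trans ?_⟩
  rw [mul_assoc]
  exact mul_le_mul_of_nonneg_left (h n) (norm_nonneg _)

theorem WeakClass.adjoint {a : ℝ} {T : H →L[ℂ] H} (hT : WeakClass a T) :
    WeakClass a (adjoint T) := by
  obtain ⟨C, hC, h⟩ := hT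
  exact ⟨C, hC, fun n => (singularValue_adjoint_le T n).trans (h n)⟩

/-- An eventual bound on the singular values gives membership in the weak class. -/
theorem weakClass_of_eventually {a C : ℝ} {T : H →L[ℂ] H} (ha : 0 ≤ a) (hC : 0 ≤ C) {k₀ : ℕ}
    (h : ∀ n : ℕ, k₀ ≤ n → singularValue T n ≤ C * ((n : ℝ) + 1) ^ (-a)) : WeakClass a T := by
  -- The second summand absorbs the indices below `k₀`, where only `s_n(T) ≤ ‖T‖` is known.
  refine ⟨C + ‖T‖ * ((k₀ : ℝ) + 1) ^ a, by positivity, fun n => ?_⟩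
  have hn : (0 : ℝ) < ((n : ℝ) + 1) ^ (-a) := by positivity
  rcases le_or_gt k₀ n with hk | hk
  · refine (h n hk).trans (mul_le_mul_of_nonneg_right ?_ hn.le)
    have : 0 ≤ ‖T‖ * ((k₀ : ℝ) + 1) ^ a := by positivity
    linarith
  · have h1 : (1 : ℝ) ≤ ((k₀ : ℝ) + 1) ^ a * ((n : ℝ) + 1) ^ (-a) := by
      rw [Real.rpow_neg (by positivity), ← div_eq_mul_inv, one_le_div (by positivity)]
      have : (n : ℝ) ≤ k₀ := mod_cast hk.le
      gcongr
    calc singularValue T n ≤ ‖T‖ := singularValue_le_norm T n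
      _ ≤ ‖T‖ * (((k₀ : ℝ) + 1) ^ a * ((n : ℝ) + 1) ^ (-a)) :=
        le_mul_of_one_le_right (norm_nonneg _) h1
      _ ≤ (C + ‖T‖ * ((k₀ : ℝ) + 1) ^ a) * ((n : ℝ) + 1) ^ (-a) := by
        rw [add_mul, mul_assoc]
        exact le_add_of_nonneg_left (by positivity)

theorem weakClass_of_rank_lt {a : ℝ} (ha : 0 ≤ a) {T : H →L[ℂ] H} {k : ℕ}
    (h : LinearMap.rank (T : H →ₗ[ℂ] H) ≤ k) : WeakClass a T :=
  weakClass_of_eventually (C := 0) (k₀ := k) ha le_rfl fun n hn => by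
    rw [singularValue_eq_zero (h.trans (mod_cast hn)), zero_mul]

theorem WeakClass.isTraceClass {a : ℝ} (ha : 1 < a) {T : H →L[ℂ] H} (hT : WeakClass a T) :
    IsTraceClass T := by
  obtain ⟨C, hC, h⟩ := hT
  refine Summable.of_nonneg_of_le (singularValue_nonneg T) h (Summable.mul_left C ?_)
  have := (summable_nat_add_iff 1).mpr (Real.summable_nat_rpow.mpr (neg_lt_neg ha))
  simpa using this

theorem isCompactOperator_of_tendsto_singularValue {T : H →L[ℂ] H}
    (h : Filter.Tendsto (singularValue T) Filter.atTop (𝓝 0)) : IsCompactOperator T := by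
  have hR : ∀ n : ℕ, ∃ R : H →L[ℂ] H, LinearMap.rank (R : H →ₗ[ℂ] H) ≤ n ∧
      ‖T - R‖ < singularValue T n + 1 / ((n : ℝ) + 1) :=
    fun n => exists_norm_sub_lt T n (by positivity)
  choose R hrank hlt using hR
  refine isCompactOperator_of_tendsto (l := Filter.atTop) (F := R) ?_
    (Filter.Eventually.of_forall fun n => ?_)
  · rw [tendsto_iff_norm_sub_tendsto_zero]
    refine squeeze_zero (fun _ => norm_nonneg _) (fun n => ?_)
      (by simpa using h.add tendsto_one_div_add_atTop_nhds_zero_nat)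
    rw [norm_sub_rev]
    simpa using (hlt n).le
  · set V : Submodule ℂ H := LinearMap.range (R n : H →ₗ[ℂ] H)
    have hV : FiniteDimensional ℂ V :=
      Module.rank_lt_aleph0_iff.mp (lt_of_le_of_lt (hrank n) (Cardinal.natCast_lt_aleph0))
    have : ProperSpace V := FiniteDimensional.proper ℂ V
    let R' : H →L[ℂ] V := (R n).codRestrict V fun x => LinearMap.mem_range_self _ x
    exact (isCompactOperator_of_locallyCompactSpace_dom R').clm_comp V.subtypeL

theorem WeakClass.tendsto_singularValue {a : ℝ} (ha : 0 < a) {T : H →L[ℂ] H}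
    (hT : WeakClass a T) : Filter.Tendsto (singularValue T) Filter.atTop (𝓝 0) := by
  obtain ⟨C, hC, h⟩ := hT
  refine squeeze_zero (singularValue_nonneg T) h ?_
  have h1 := (tendsto_rpow_neg_atTop ha).comp
    (Filter.tendsto_atTop_add_const_right _ (1 : ℝ) tendsto_natCast_atTop_atTop)
  simpa using h1.const_mul C

end SingularValues

/-! ### Ky Fan's inequality and its extremal vectors -/

section KyFan

variable {H : Type*} [NormedAddCommGroup H] [InnerProductSpace ℂ H] [CompleteSpace H]

theorem exists_apply_eq_norm_smul {B : H →L[ℂ] H} (hB : B.IsPositive)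
    (hc : IsCompactOperator B) (h0 : B ≠ 0) : ∃ v : H, ‖v‖ = 1 ∧ B v = (‖B‖ : ℂ) • v := by
  have hnt : Nontrivial H := by
    by_contra h
    rw [not_nontrivial_iff_subsingleton] at h
    exact h0 (by ext x; exact Subsingleton.elim _ _)
  have h1 : ‖B‖ ∈ spectrum ℝ B :=
    CStarAlgebra.norm_mem_spectrum_of_nonneg ((nonneg_iff_isPositive B).mpr hB)
  have h2 : ((‖B‖ : ℝ) : ℂ) ∈ spectrum ℂ B := spectrum.algebraMap_mem ℂ h1
  have h3 : ((‖B‖ : ℝ) : ℂ) ≠ 0 := by simpa using h0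
  obtain ⟨v, hv⟩ := ((hc.hasEigenvalue_iff_mem_spectrum h3).mpr h2).exists_hasEigenvector
  have hv1 : B v = ((‖B‖ : ℝ) : ℂ) • v := hv.apply_eq_smul
  have hv0 : ‖v‖ ≠ 0 := norm_ne_zero_iff.mpr hv.2
  refine ⟨((‖v‖⁻¹ : ℝ) : ℂ) • v, ?_, ?_⟩
  · rw [norm_smul, Complex.norm_real, norm_inv, norm_norm, inv_mul_cancel₀ hv0]
  · rw [map_smul, hv1, smul_comm]

theorem sum_range_singularValue_nonneg (T : H →L[ℂ] H) (N : ℕ) :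
    0 ≤ ∑ k ∈ Finset.range N, singularValue T k :=
  Finset.sum_nonneg fun _ _ => singularValue_nonneg T _

/-- The largest eigenvalues of a positive compact operator dominate its singular values. -/
theorem exists_eigenvectors_sum_singularValue_le (N : ℕ) :
    ∀ B : H →L[ℂ] H, B.IsPositive → IsCompactOperator B →
      ∃ n ≤ N, ∃ (e : Fin n → H) (μ : Fin n → ℝ), Orthonormal ℂ e ∧ (∀ i, 0 < μ i) ∧
        (∀ i, B (e i) = (μ i : ℂ) • e i) ∧
        ∑ k ∈ Finset.range N, singularValue B k ≤ ∑ i, μ i := by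
  induction N with
  | zero =>
    intro B _ _
    exact ⟨0, le_rfl, Fin.elim0, Fin.elim0, ⟨fun i => i.elim0, fun i => i.elim0⟩,
      fun i => i.elim0, fun i => i.elim0, by simp⟩
  | succ N ih =>
    intro B hB hc
    -- Once `B` is zero the family stops, so it may have fewer than `N` members; this keeps every `μ
    -- i` strictly positive.
    rcases eq_or_ne B 0 with h0 | h0
    · refine ⟨0, Nat.zero_le _, Fin.elim0, Fin.elim0, ⟨fun i => i.elim0, fun i => i.elim0⟩,
        fun i => i.elim0, fun i => i.elim0, ?_⟩
      have : ∀ k, singularValue B k = 0 := fun k => singularValue_eq_zero (by simp [h0])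
      simp [this]
    obtain ⟨f, hf, hBf⟩ := exists_apply_eq_norm_smul hB hc h0
    set P : H →L[ℂ] H := (ℂ ∙ f).starProjection with hP
    have hPx : ∀ x, P x = inner ℂ f x • f := Submodule.starProjection_unit_singleton ℂ hf
    have hff : inner ℂ f f = (1 : ℂ) := by rw [inner_self_eq_norm_sq_to_K, hf]; simp
    have hPf : P f = f := by rw [hPx, hff, one_smul]
    have hBsymm : ∀ x y, inner ℂ (B x) y = inner ℂ x (B y) := hB.isSelfAdjoint.isSymmetric
    have hPB : ∀ x, P (B x) = (‖B‖ : ℂ) • P x := fun x => by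
      rw [hPx, hPx, ← hBsymm, hBf, inner_smul_left, Complex.conj_ofReal, smul_smul]
    have hBP : ∀ x, B (P x) = (‖B‖ : ℂ) • P x := fun x => by
      rw [hPx, map_smul, hBf, smul_comm]
    have hPP : ∀ x, P (P x) = P x := fun x => by rw [hPx x, map_smul, hPf]
    set B' : H →L[ℂ] H := B - P * B with hB'
    have hB'eq : B' = (1 - P) ∘L B ∘L adjoint (1 - P) := by
      have : adjoint (1 - P) = 1 - P := by
        rw [← star_eq_adjoint]
        exact ((IsSelfAdjoint.one _).sub (isSelfAdjoint_starProjection _)).star_eq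
      rw [this]
      ext x
      simp [hB', hPB, hBP, hPP]
    have hB'pos : B'.IsPositive := hB'eq ▸ hB.conj_adjoint _
    have hB'c : IsCompactOperator B' := hc.sub (hc.clm_comp P)
    obtain ⟨n, hn, e, μ, he, hμ, hBe, hsum⟩ := ih B' hB'pos hB'c
    have hPB' : ∀ x, P (B' x) = 0 := fun x => by simp [hB', hPP]
    have hPe : ∀ i, P (e i) = 0 := fun i => by
      have h1 := hPB' (e i)
      rw [hBe, map_smul] at h1
      exact (smul_eq_zero.mp h1).resolve_left (by exact_mod_cast (hμ i).ne')
    have hfe : ∀ i, inner ℂ f (e i) = (0 : ℂ) := fun i => by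
      have h1 := hPe i
      rw [hPx] at h1
      refine (smul_eq_zero.mp h1).resolve_right ?_
      rintro rfl
      simp at hf
    refine ⟨n + 1, by lia, Fin.cons f e, Fin.cons ‖B‖ μ, ⟨?_, ?_⟩, ?_, ?_, ?_⟩
    · intro i
      refine Fin.cases ?_ (fun i => ?_) i
      · simpa using hf
      · simpa using he.1 i
    · intro i j
      refine Fin.cases ?_ (fun i => ?_) i <;> refine Fin.cases ?_ (fun j => ?_) j
      · simp
      · intro _
        simpa using hfe j
      · intro _
        simpa using inner_eq_zero_symm.mp (hfe i)
      · intro hij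
        simpa using he.2 (fun h => hij (congrArg _ h))
    · intro i
      refine Fin.cases ?_ (fun i => ?_) i
      · simpa using h0
      · simpa using hμ i
    · intro i
      refine Fin.cases ?_ (fun i => ?_) i
      · simpa using hBf
      · have h1 := hBe i
        change B (e i) - P (B (e i)) = _ at h1
        rw [hPB, hPe, smul_zero, sub_zero] at h1
        simpa using h1
    · rw [Finset.sum_range_succ', Fin.sum_univ_succ, add_comm]
      simp only [Fin.cons_zero, Fin.cons_succ]
      refine add_le_add (singularValue_le_norm B 0) (le_trans ?_ hsum)
      refine Finset.sum_le_sum fun k _ => ?_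
      -- The removed piece has rank one, so `s_{k+1}(B) ≤ s_k(B')`.
      have h1 := singularValue_add_le B' (P * B) k 1
      rw [hB', sub_add_cancel] at h1
      have h2 : LinearMap.rank ((P * B : H →L[ℂ] H) : H →ₗ[ℂ] H) ≤ (1 : ℕ) := by
        refine (LinearMap.rank_comp_le_left _ _).trans ?_
        refine (Submodule.rank_mono (t := ℂ ∙ f) ?_).trans ?_
        · rintro _ ⟨x, rfl⟩
          exact Submodule.starProjection_apply_mem _ x
        · simpa using rank_span_le (R := ℂ) ({f} : Set H)
      rwa [singularValue_eq_zero h2, add_zero] at h1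

/-- Ky Fan's inequality: the trace over an orthonormal family is bounded by the sum of the singular
values. -/
theorem sum_inner_le_sum_singularValue {T : H →L[ℂ] H} (hT : IsSelfAdjoint T) {N : ℕ}
    {e : Fin N → H} (he : Orthonormal ℂ e) :
    ∑ i, (inner ℂ (e i) (T (e i))).re ≤ ∑ k ∈ Finset.range N, singularValue T k := by
  set V : Submodule ℂ H := Submodule.span ℂ (Set.range e) with hV
  have hmem : ∀ i, e i ∈ V := fun i => Submodule.subset_span ⟨i, rfl⟩
  let e' : Fin N → V := fun i => ⟨e i, hmem i⟩
  have he' : Orthonormal ℂ e' := ⟨fun i => he.1 i, fun i j hij => he.2 hij⟩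
  have hspan : ⊤ ≤ Submodule.span ℂ (Set.range e') := by
    rw [top_le_iff]
    refine Submodule.map_injective_of_injective V.injective_subtype ?_
    rw [Submodule.map_span, ← Set.range_comp, Submodule.map_top, Submodule.range_subtype]
    rfl
  let b : OrthonormalBasis (Fin N) ℂ V := OrthonormalBasis.mk he' hspan
  have hfin : FiniteDimensional ℂ V := b.toBasis.finiteDimensional_of_finite
  -- The sum is the trace of this compression, hence the sum of its eigenvalues. It remains to bound
  -- the `k`-th eigenvalue by the `k`-th singular value of `T`.
  let A : V →L[ℂ] V := V.orthogonalProjectionOnto ∘L T ∘L V.subtypeL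
  have hA : ∀ x y : V, inner ℂ x (A y) = inner ℂ (x : H) (T y) := fun x y => by
    simp [A]
  have hsymm : (A : V →ₗ[ℂ] V).IsSymmetric := fun x y => by
    rw [← inner_conj_symm]
    change (starRingEnd ℂ) (inner ℂ y (A x)) = inner ℂ x (A y)
    rw [hA, hA, inner_conj_symm]
    exact hT.isSymmetric x y
  have hn : Module.finrank ℂ V = N := by simpa using Module.finrank_eq_card_basis b.toBasis
  have htrace := (LinearMap.trace_eq_sum_inner (A : V →ₗ[ℂ] V) b).symm.trans
    (hsymm.trace_eq_sum_eigenvalues hn)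
  have hsum : ∑ i, (inner ℂ (e i) (T (e i))).re = ∑ i, hsymm.eigenvalues hn i := by
    have h1 := congrArg Complex.re htrace
    rw [Complex.re_sum] at h1
    refine Eq.trans (Finset.sum_congr rfl fun i _ => ?_) (h1.trans (Complex.ofReal_re _))
    change _ = (inner ℂ (b i) (A (b i))).re
    rw [hA, OrthonormalBasis.coe_mk]
  rw [hsum, Finset.sum_range]
  refine Finset.sum_le_sum fun k _ => ?_
  rcases le_or_gt (hsymm.eigenvalues hn k) 0 with hk | hk
  · exact hk.trans (singularValue_nonneg _ _)
  set u := hsymm.eigenvectorBasis hn with hu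
  -- On the span of the top `k + 1` eigenvectors `T` expands norms at least by the `k`-th
  -- eigenvalue, so min-max applies.
  let w : Fin (k + 1) → H := fun i => u ⟨i, by lia⟩
  have hw : Orthonormal ℂ w :=
    ⟨fun i => u.orthonormal.1 _, fun i j hij => u.orthonormal.2 (by simpa [Fin.ext_iff] using hij)⟩
  set W : Submodule ℂ H := Submodule.span ℂ (Set.range w)
  have hWfin : FiniteDimensional ℂ W := FiniteDimensional.span_of_finite ℂ (Set.finite_range w)
  have hWrank : Module.finrank ℂ W = k + 1 := by
    simpa using finrank_span_eq_card hw.linearIndependent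
  refine le_singularValue_of_subspace (V := W) (by lia) fun v hv => ?_
  have hWV : W ≤ V := Submodule.span_le.mpr (by rintro _ ⟨i, rfl⟩; exact (u _).2)
  have hperp : ∀ i : Fin N, k < i → inner ℂ (u i : H) v = (0 : ℂ) := by
    intro i hi
    refine Submodule.span_induction (p := fun v _ => inner ℂ (u i : H) v = (0 : ℂ)) ?_ ?_ ?_ ?_ hv
    · rintro _ ⟨j, rfl⟩
      exact u.orthonormal.2 (by
        intro h
        have h1 := congrArg Fin.val h
        have h2 : (k : ℕ) < i := hi
        simp only at h1
        lia)
    · exact inner_zero_right _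
    · intro x y _ _ hx hy
      rw [inner_add_right, hx, hy, add_zero]
    · intro c x _ hx
      rw [inner_smul_right, hx, mul_zero]
  let v' : V := ⟨v, hWV hv⟩
  have hle : ‖A v'‖ ≤ ‖T v‖ := by
    exact V.norm_orthogonalProjectionOnto_apply_le (T v)
  refine le_trans ?_ hle
  refine le_of_sq_le_sq ?_ (norm_nonneg _)
  rw [mul_pow, show ‖v‖ = ‖v'‖ from rfl, ← u.sum_sq_norm_inner_right v',
    ← u.sum_sq_norm_inner_right (A v'), Finset.mul_sum]
  refine Finset.sum_le_sum fun i _ => ?_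
  have h1 : inner ℂ (u i) (A v') = (hsymm.eigenvalues hn i : ℂ) * inner ℂ (u i) v' := by
    have h2 := hsymm (u i) v'
    change inner ℂ (A (u i)) v' = inner ℂ (u i) (A v') at h2
    have h3 : A (u i) = (hsymm.eigenvalues hn i : ℂ) • u i := hsymm.apply_eigenvectorBasis hn i
    rw [← h2, h3, inner_smul_left, Complex.conj_ofReal]
  rw [h1, norm_mul, mul_pow, Complex.norm_real, Real.norm_eq_abs, sq_abs]
  rcases lt_or_ge k i with hki | hki
  · have : inner ℂ (u i) v' = (0 : ℂ) := hperp i hki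
    simp [this]
  · have := hsymm.eigenvalues_antitone hn hki
    gcongr

end KyFan

/-! ### Dixmier traces under trace class perturbations -/

section Dixmier

variable {H : Type*} [NormedAddCommGroup H] [InnerProductSpace ℂ H] [CompleteSpace H]

theorem posPart_isPositive (S : H →L[ℂ] H) : (S⁺).IsPositive :=
  (nonneg_iff_isPositive _).mp (CFC.posPart_nonneg S)

theorem negPart_isPositive (S : H →L[ℂ] H) : (S⁻).IsPositive :=
  (nonneg_iff_isPositive _).mp (CFC.negPart_nonneg S)

theorem posPart_apply_sub_negPart_apply {S : H →L[ℂ] H} (hS : IsSelfAdjoint S) (v : H) :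
    S⁺ v - S⁻ v = S v :=
  congrArg (fun T : H →L[ℂ] H => T v) (CFC.posPart_sub_negPart S hS)

theorem negPart_apply_posPart_apply (S : H →L[ℂ] H) (v : H) : S⁻ (S⁺ v) = 0 :=
  congrArg (fun T : H →L[ℂ] H => T v) (CFC.negPart_mul_posPart S)

/-- The vectors `S⁺ v` and `S⁻ v` are orthogonal because `S⁻ S⁺ = 0`, so Pythagoras applies to `S
v`. -/
theorem norm_posPart_apply_le {S : H →L[ℂ] H} (hS : IsSelfAdjoint S) (v : H) :
    ‖S⁺ v‖ ≤ ‖S v‖ := by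
  have horth : inner ℂ (S⁺ v) (-S⁻ v) = (0 : ℂ) := by
    have h := (negPart_isPositive S).isSelfAdjoint.isSymmetric (S⁺ v) v
    change inner ℂ (S⁻ (S⁺ v)) v = inner ℂ (S⁺ v) (S⁻ v) at h
    rw [inner_neg_right, ← h, negPart_apply_posPart_apply, inner_zero_left, neg_zero]
  have h := norm_add_sq_eq_norm_sq_add_norm_sq_of_inner_eq_zero _ _ horth
  rw [← sub_eq_add_neg, posPart_apply_sub_negPart_apply hS] at h
  nlinarith [norm_nonneg (S v), norm_nonneg (S⁺ v), norm_nonneg (-S⁻ v)]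

theorem singularValue_posPart_le {S : H →L[ℂ] H} (hS : IsSelfAdjoint S) (n : ℕ) :
    singularValue S⁺ n ≤ singularValue S n :=
  singularValue_le_of_norm_apply_le (norm_posPart_apply_le hS) n

theorem WeakClass.posPart {a : ℝ} {S : H →L[ℂ] H} (hS : IsSelfAdjoint S) (h : WeakClass a S) :
    WeakClass a S⁺ := by
  obtain ⟨C, hC, hle⟩ := h
  exact ⟨C, hC, fun n => (singularValue_posPart_le hS n).trans (hle n)⟩

/-- Eigenvectors of `(S + Y)⁺` with positive eigenvalue are killed by `(S + Y)⁻`. The eigenvalue is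
therefore `⟨e, (S + Y) e⟩ ≤ ⟨e, S⁺ e⟩ + ⟨e, Y e⟩`, and Ky Fan's inequality bounds the two sums
separately. -/
theorem sum_singularValue_posPart_add_le {S Y : H →L[ℂ] H} (hS : IsSelfAdjoint S)
    (hY : IsSelfAdjoint Y) (hc : Filter.Tendsto (singularValue (S + Y)) Filter.atTop (𝓝 0))
    (hY1 : IsTraceClass Y) (N : ℕ) :
    ∑ k ∈ Finset.range N, singularValue (S + Y)⁺ k ≤
      ∑ k ∈ Finset.range N, singularValue S⁺ k + ∑' k, singularValue Y k := by
  have hSY := hS.add hY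
  have hcomp : IsCompactOperator ((S + Y)⁺ : H →L[ℂ] H) := isCompactOperator_of_tendsto_singularValue
    (squeeze_zero (singularValue_nonneg _) (singularValue_posPart_le hSY) hc)
  obtain ⟨n, hn, e, μ, he, hμ, hBe, hsum⟩ :=
    exists_eigenvectors_sum_singularValue_le N _ (posPart_isPositive (S + Y)) hcomp
  have hneg : ∀ i, (S + Y)⁻ (e i) = 0 := fun i => by
    have h1 := negPart_apply_posPart_apply (S + Y) (e i)
    rw [hBe, map_smul] at h1
    exact (smul_eq_zero.mp h1).resolve_left (by exact_mod_cast (hμ i).ne')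
  have hval : ∀ i, μ i ≤ (inner ℂ (e i) (S⁺ (e i))).re + (inner ℂ (e i) (Y (e i))).re := by
    intro i
    have h1 := posPart_apply_sub_negPart_apply hSY (e i)
    rw [hneg, sub_zero, hBe] at h1
    have h2 : (inner ℂ (e i) ((S + Y) (e i))).re = μ i := by
      rw [← h1, inner_smul_right, inner_self_eq_norm_sq_to_K, he.1 i]
      simp
    have h3 : 0 ≤ (inner ℂ (e i) (S⁻ (e i))).re :=
      (negPart_isPositive S).re_inner_nonneg_right (e i)
    have h4 := posPart_apply_sub_negPart_apply hS (e i)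
    rw [← h2, _root_.add_apply, inner_add_right, Complex.add_re, ← h4, inner_sub_right,
      Complex.sub_re]
    linarith
  refine hsum.trans ((Finset.sum_le_sum fun i _ => hval i).trans ?_)
  rw [Finset.sum_add_distrib]
  refine add_le_add ?_ ?_
  · refine (sum_inner_le_sum_singularValue (posPart_isPositive S).isSelfAdjoint he).trans ?_
    exact Finset.sum_le_sum_of_subset_of_nonneg (Finset.range_mono hn)
      fun k _ _ => singularValue_nonneg _ _
  · exact (sum_inner_le_sum_singularValue hY he).trans
      (hY1.sum_le_tsum _ fun k _ => singularValue_nonneg _ _)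

theorem partialSum_eq_convexCombination (T : H →L[ℂ] H) (r : ℝ) :
    partialSum T r = (1 - (r - ⌊r⌋₊)) * ∑ k ∈ Finset.range ⌊r⌋₊, singularValue T k +
      (r - ⌊r⌋₊) * ∑ k ∈ Finset.range (⌊r⌋₊ + 1), singularValue T k := by
  rw [partialSum, Finset.sum_range_succ]
  ring

theorem partialSum_le_add {A B : H →L[ℂ] H} {C : ℝ}
    (h : ∀ N, ∑ k ∈ Finset.range N, singularValue A k ≤
      ∑ k ∈ Finset.range N, singularValue B k + C) {r : ℝ} (hr : 0 ≤ r) :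
    partialSum A r ≤ partialSum B r + C := by
  rw [partialSum_eq_convexCombination, partialSum_eq_convexCombination]
  have h1 : 0 ≤ r - ⌊r⌋₊ := sub_nonneg.mpr (Nat.floor_le hr)
  have h2 : 0 ≤ 1 - (r - ⌊r⌋₊) := by linarith [Nat.lt_floor_add_one r]
  have h3 := mul_le_mul_of_nonneg_left (h ⌊r⌋₊) h2
  have h4 := mul_le_mul_of_nonneg_left (h (⌊r⌋₊ + 1)) h1
  linarith

theorem partialSum_nonneg (T : H →L[ℂ] H) {r : ℝ} (hr : 0 ≤ r) : 0 ≤ partialSum T r :=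
  add_nonneg (sum_range_singularValue_nonneg T _)
    (mul_nonneg (sub_nonneg.mpr (Nat.floor_le hr)) (singularValue_nonneg _ _))

/-- Unlike the definition through `⌊r⌋₊`, this form is visibly continuous in `r`. -/
theorem partialSum_eq_sum_clamp (T : H →L[ℂ] H) {N : ℕ} {r : ℝ} (hr : 0 ≤ r) (hN : r < N) :
    partialSum T r = ∑ k ∈ Finset.range N, max 0 (min 1 (r - k)) * singularValue T k := by
  have hfl : ⌊r⌋₊ + 1 ≤ N := (Nat.floor_lt hr).mpr hN
  rw [← Finset.sum_subset (Finset.range_mono hfl), Finset.sum_range_succ, partialSum]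
  · congr 1
    · refine Finset.sum_congr rfl fun k hk => ?_
      have h1 : ((k + 1 : ℕ) : ℝ) ≤ r := by
        refine le_trans ?_ (Nat.floor_le hr)
        exact_mod_cast Finset.mem_range.mp hk
      push_cast at h1
      rw [min_eq_left (by linarith), max_eq_right zero_le_one, one_mul]
    · rw [min_eq_right (by linarith [Nat.lt_floor_add_one r]),
        max_eq_right (sub_nonneg.mpr (Nat.floor_le hr))]
  · intro k _ hk
    have h1 : r < k := (Nat.floor_lt hr).mp (by simpa using hk)
    rw [max_eq_left (min_le_of_right_le (by linarith)), zero_mul]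

theorem continuous_partialSum (T : H →L[ℂ] H) :
    Continuous fun r : Set.Ici (Real.exp 1) => partialSum T r := by
  rw [continuous_iff_continuousAt]
  intro x
  obtain ⟨N, hN⟩ := exists_nat_gt (x : ℝ)
  have hcont : Continuous fun r : Set.Ici (Real.exp 1) =>
      ∑ k ∈ Finset.range N, max 0 (min 1 ((r : ℝ) - k)) * singularValue T k := by fun_prop
  refine hcont.continuousAt.congr ?_
  have : ∀ᶠ r : Set.Ici (Real.exp 1) in 𝓝 x, (r : ℝ) < N :=
    continuous_subtype_val.continuousAt.eventually_lt_const hN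
  filter_upwards [this] with r hr
  exact (partialSum_eq_sum_clamp T ((Real.exp_pos 1).le.trans r.2) hr).symm

theorem one_le_log {r : ℝ} (hr : Real.exp 1 ≤ r) : 1 ≤ Real.log r :=
  (Real.le_log_iff_exp_le ((Real.exp_pos 1).trans_le hr)).mpr hr

theorem WeakClass.memDixmierIdeal {T : H →L[ℂ] H} (hT : WeakClass 1 T) : MemDixmierIdeal T := by
  obtain ⟨C, hC, h⟩ := hT
  -- The harmonic sum gives `1 + log 2 + log r`, and each of the three terms is at most `log r`
  -- since `r ≥ e`.
  refine ⟨C * 3, fun r hr => ?_⟩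
  have hr0 : 0 < r := (Real.exp_pos 1).trans_le hr
  have hr1 : 1 ≤ r := (Real.one_le_exp zero_le_one).trans hr
  have hlog := one_le_log hr
  have hsum : ∀ N : ℕ, ∑ k ∈ Finset.range N, singularValue T k ≤ C * (1 + Real.log N) := by
    intro N
    refine le_trans ?_ (mul_le_mul_of_nonneg_left (harmonic_le_one_add_log N) hC)
    rw [harmonic]
    push_cast
    rw [Finset.mul_sum]
    refine Finset.sum_le_sum fun k _ => (h k).trans_eq ?_
    rw [Real.rpow_neg_one]
  have h1 : partialSum T r ≤ ∑ k ∈ Finset.range (⌊r⌋₊ + 1), singularValue T k := by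
    rw [partialSum, Finset.sum_range_succ]
    have : r - ⌊r⌋₊ ≤ 1 := by linarith [Nat.lt_floor_add_one r]
    gcongr
    exact mul_le_of_le_one_left (singularValue_nonneg _ _) this
  have h2 : Real.log ((⌊r⌋₊ + 1 : ℕ) : ℝ) ≤ Real.log 2 + Real.log r := by
    rw [← Real.log_mul two_ne_zero hr0.ne']
    refine Real.log_le_log (by positivity) ?_
    push_cast
    linarith [Nat.floor_le hr0.le]
  have h3 : Real.log 2 ≤ 1 := by linarith [Real.log_two_lt_d9]
  rw [mul_assoc]
  refine h1.trans ((hsum _).trans (mul_le_mul_of_nonneg_left ?_ hC))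
  linarith

theorem exists_boundedContinuousFunction {T : H →L[ℂ] H} (hT : MemDixmierIdeal T) :
    ∃ f : Set.Ici (Real.exp 1) →ᵇ ℝ, ∀ r, f r = partialSum T r / Real.log r := by
  obtain ⟨C, hC⟩ := hT
  have hlog : ∀ r : Set.Ici (Real.exp 1), 1 ≤ Real.log r := fun r => one_le_log r.2
  have hpos : ∀ r : Set.Ici (Real.exp 1), (0 : ℝ) < r := fun r => (Real.exp_pos 1).trans_le r.2
  refine ⟨BoundedContinuousFunction.ofNormedAddCommGroup
    (fun r => partialSum T r / Real.log r) ?_ C fun r => ?_, fun r => rfl⟩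
  · refine (continuous_partialSum T).div ?_ fun r => (zero_lt_one.trans_le (hlog r)).ne'
    exact continuous_subtype_val.log fun r => (hpos r).ne'
  · have h1 : 0 < Real.log r := zero_lt_one.trans_le (hlog r)
    rw [Real.norm_eq_abs, abs_of_nonneg (div_nonneg (partialSum_nonneg T (hpos r).le) h1.le),
      div_le_iff₀ h1]
    exact hC r r.2

/-- A bounded difference of partial sums becomes `O(1 / log r)`, on which the extended limit
vanishes. -/
theorem dixmierTracePos_congr (ω : ExtendedLimit) {A B : H →L[ℂ] H} (hA : MemDixmierIdeal A)
    (hB : MemDixmierIdeal B) {C : ℝ}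
    (h : ∀ N, |∑ k ∈ Finset.range N, singularValue A k -
      ∑ k ∈ Finset.range N, singularValue B k| ≤ C) :
    dixmierTracePos ω A = dixmierTracePos ω B := by
  have hfA := exists_boundedContinuousFunction hA
  have hfB := exists_boundedContinuousFunction hB
  rw [dixmierTracePos, dixmierTracePos, dif_pos hfA, dif_pos hfB, ← sub_eq_zero, ← map_sub]
  refine ω.map_of_tendsto_zero _ ?_
  have hle : ∀ r : Set.Ici (Real.exp 1), |partialSum A r - partialSum B r| ≤ C := fun r => by
    have hr : (0 : ℝ) ≤ r := (Real.exp_pos 1).le.trans r.2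
    rw [abs_sub_le_iff]
    constructor
    · linarith [partialSum_le_add (A := A) (B := B) (C := C)
        (fun N => by linarith [(abs_sub_le_iff.mp (h N)).1]) hr]
    · linarith [partialSum_le_add (A := B) (B := A) (C := C)
        (fun N => by linarith [(abs_sub_le_iff.mp (h N)).2]) hr]
  have hlim : Filter.Tendsto (fun r : Set.Ici (Real.exp 1) => C / Real.log r)
      Filter.atTop (𝓝 0) := by
    refine Filter.Tendsto.const_div_atTop (Real.tendsto_log_atTop.comp ?_) C
    exact Filter.tendsto_Ici_atTop.mp Filter.tendsto_id
  refine squeeze_zero_norm (fun r => ?_) hlim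
  have hlog : 0 < Real.log r := zero_lt_one.trans_le (one_le_log r.2)
  rw [BoundedContinuousFunction.sub_apply, hfA.choose_spec, hfB.choose_spec, ← sub_div, norm_div,
    Real.norm_eq_abs, Real.norm_eq_abs, abs_of_pos hlog]
  exact div_le_div_of_nonneg_right (hle r) hlog.le

theorem dixmierTracePos_posPart_add (ω : ExtendedLimit) {S Y : H →L[ℂ] H} (hS : IsSelfAdjoint S)
    (hY : IsSelfAdjoint Y) (hS1 : WeakClass 1 S) {a : ℝ} (ha : 1 < a) (hY1 : WeakClass a Y)
    (hSY1 : WeakClass 1 (S + Y)) :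
    dixmierTracePos ω (S + Y)⁺ = dixmierTracePos ω S⁺ := by
  have hYt := hY1.isTraceClass ha
  refine dixmierTracePos_congr ω (hSY1.posPart (hS.add hY)).memDixmierIdeal
    (hS1.posPart hS).memDixmierIdeal (C := ∑' k, singularValue Y k) fun N => ?_
  rw [abs_sub_le_iff]
  constructor
  · linarith [sum_singularValue_posPart_add_le hS hY
      (hSY1.tendsto_singularValue zero_lt_one) hYt N]
  -- The reverse inequality is the same one, with `S` seen as the perturbation of `S + Y` by `-Y`.
  · have h1 := sum_singularValue_posPart_add_le (S := S + Y) (Y := -Y) (hS.add hY) hY.neg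
      (by simpa using hS1.tendsto_singularValue zero_lt_one)
      ((hY1.neg).isTraceClass ha) N
    simp only [add_neg_cancel_right, singularValue_neg] at h1
    linarith

theorem dixmierTracePos_negPart_add (ω : ExtendedLimit) {S Y : H →L[ℂ] H} (hS : IsSelfAdjoint S)
    (hY : IsSelfAdjoint Y) (hS1 : WeakClass 1 S) {a : ℝ} (ha : 1 < a) (hY1 : WeakClass a Y)
    (hSY1 : WeakClass 1 (S + Y)) :
    dixmierTracePos ω (S + Y)⁻ = dixmierTracePos ω S⁻ := by
  rw [← CFC.posPart_neg, ← CFC.posPart_neg, neg_add]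
  exact dixmierTracePos_posPart_add ω hS.neg hY.neg hS1.neg ha hY1.neg
    (by rw [← neg_add]; exact hSY1.neg)

theorem WeakClass.realPart {a : ℝ} (ha : 0 ≤ a) {T : H →L[ℂ] H} (hT : WeakClass a T) :
    WeakClass a (ℜ T : H →L[ℂ] H) := by
  rw [realPart_apply_coe, ← Complex.coe_smul]
  exact (hT.add ha hT.adjoint).smul _

theorem WeakClass.imaginaryPart {a : ℝ} (ha : 0 ≤ a) {T : H →L[ℂ] H} (hT : WeakClass a T) :
    WeakClass a (ℑ T : H →L[ℂ] H) := by
  rw [imaginaryPart_apply_coe, ← Complex.coe_smul]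
  exact ((hT.sub ha hT.adjoint).smul _).smul _

/-- The four positive operators defining the trace are compared one by one, so additivity of the
Dixmier trace is never invoked. -/
theorem dixmierTrace_add_eq (ω : ExtendedLimit) {A Z : H →L[ℂ] H} (hA : WeakClass 1 A) {a : ℝ}
    (ha : 1 < a) (hZ : WeakClass a Z) (hAZ : WeakClass 1 (A + Z)) :
    dixmierTrace ω (A + Z) = dixmierTrace ω A := by
  have hre := hAZ.realPart zero_le_one
  have him := hAZ.imaginaryPart zero_le_one
  have ha0 : 0 ≤ a := zero_le_one.trans ha.le
  rw [map_add, AddSubgroup.coe_add] at hre him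
  rw [dixmierTrace, dixmierTrace, map_add, map_add, AddSubgroup.coe_add, AddSubgroup.coe_add,
    dixmierTracePos_posPart_add ω (ℜ A).2 (ℜ Z).2 (hA.realPart zero_le_one) ha
      (hZ.realPart ha0) hre,
    dixmierTracePos_negPart_add ω (ℜ A).2 (ℜ Z).2 (hA.realPart zero_le_one) ha
      (hZ.realPart ha0) hre,
    dixmierTracePos_posPart_add ω (ℑ A).2 (ℑ Z).2 (hA.imaginaryPart zero_le_one) ha
      (hZ.imaginaryPart ha0) him,
    dixmierTracePos_negPart_add ω (ℑ A).2 (ℑ Z).2 (hA.imaginaryPart zero_le_one) ha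
      (hZ.imaginaryPart ha0) him]

end Dixmier

/-! ### Operators diagonal in a Hilbert basis -/

section Diagonal

variable {H : Type*} [NormedAddCommGroup H] [InnerProductSpace ℂ H] [CompleteSpace H]
variable {ι κ : Type*}

theorem clm_ext_basis {F : Type*} [NormedAddCommGroup F] [NormedSpace ℂ F]
    (b : HilbertBasis ι ℂ H) {A B : H →L[ℂ] F} (h : ∀ i, A (b i) = B (b i)) : A = B := by
  refine ContinuousLinearMap.ext_on (s := Set.range b) ?_ ?_
  · rw [Submodule.dense_iff_topologicalClosure_eq_top]
    exact b.dense_span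
  · rintro _ ⟨i, rfl⟩
    exact h i

theorem ext_inner_basis (b : HilbertBasis ι ℂ H) {x y : H}
    (h : ∀ i, inner ℂ (b i) x = inner ℂ (b i) y) : x = y := by
  refine b.repr.injective (lp.ext (funext fun i => ?_))
  rw [b.repr_apply_apply, b.repr_apply_apply, h]

/-- Operator identities mixing `D` and `D + M` are checked on mixed matrix coefficients, where
functions of `D + M` on the left and of `D` on the right become scalars. -/
theorem clm_ext_inner_basis (b : HilbertBasis ι ℂ H) (b' : HilbertBasis κ ℂ H)
    {A B : H →L[ℂ] H} (h : ∀ i j, inner ℂ (b' j) (A (b i)) = inner ℂ (b' j) (B (b i))) :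
    A = B :=
  clm_ext_basis b fun i => ext_inner_basis b' fun j => h i j

/-- A bounded family of scalars. -/
def BddFun (f : ι → ℝ) : Prop := ∃ C : ℝ, ∀ i, |f i| ≤ C

theorem exists_diagonal (b : HilbertBasis ι ℂ H) {f : ι → ℝ} {C : ℝ} (hC : 0 ≤ C)
    (hf : ∀ i, |f i| ≤ C) :
    ∃ T : H →L[ℂ] H, (∀ i, T (b i) = (f i : ℂ) • b i) ∧ ‖T‖ ≤ C := by
  classical
  have hle : ∀ (x : lp (fun _ : ι => ℂ) 2) (i : ι),
      ‖(f i : ℂ) * x i‖ ≤ ‖((C : ℂ) • x : lp (fun _ : ι => ℂ) 2) i‖ := fun x i => by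
    rw [lp.coeFn_smul, Pi.smul_apply, norm_mul, norm_smul, Complex.norm_real, Complex.norm_real,
      Real.norm_eq_abs, Real.norm_eq_abs, abs_of_nonneg hC]
    exact mul_le_mul_of_nonneg_right (hf i) (norm_nonneg _)
  have hmem : ∀ x : lp (fun _ : ι => ℂ) 2, Memℓp (fun i => (f i : ℂ) * x i) 2 := fun x =>
    (lp.memℓp ((C : ℂ) • x : lp (fun _ : ι => ℂ) 2)).mono' (hle x)
  let m : lp (fun _ : ι => ℂ) 2 →ₗ[ℂ] lp (fun _ : ι => ℂ) 2 :=
    { toFun := fun x => ⟨fun i => (f i : ℂ) * x i, hmem x⟩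
      map_add' := fun x y => by
        ext i
        exact mul_add _ _ _
      map_smul' := fun c x => by
        ext i
        exact mul_left_comm _ _ _ }
  have hm : ∀ x, ‖m x‖ ≤ C * ‖x‖ := fun x => by
    have h1 := lp.norm_mono (p := 2) two_ne_zero (x := m x) (y := (C : ℂ) • x) (hle x)
    rwa [norm_smul, Complex.norm_real, Real.norm_eq_abs, abs_of_nonneg hC] at h1
  let e := b.repr
  let T : H →ₗ[ℂ] H :=
    (e.symm.toLinearEquiv : _ →ₗ[ℂ] H) ∘ₗ m ∘ₗ (e.toLinearEquiv : H →ₗ[ℂ] _)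
  have hTx : ∀ x, T x = e.symm (m (e x)) := fun x => rfl
  have hT : ∀ x, ‖T x‖ ≤ C * ‖x‖ := fun x => by
    rw [hTx, LinearIsometryEquiv.norm_map]
    simpa using hm (e x)
  refine ⟨T.mkContinuous C hT, fun i => ?_, T.mkContinuous_norm_le hC hT⟩
  change e.symm (m (e (b i))) = _
  rw [LinearIsometryEquiv.symm_apply_eq, map_smul]
  ext j
  change (f j : ℂ) * e (b i) j = (f i : ℂ) * e (b i) j
  rw [show e (b i) = lp.single 2 i (1 : ℂ) from b.repr_self i]
  rcases eq_or_ne j i with rfl | hji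
  · rfl
  · rw [lp.single_apply_ne _ _ _ hji, mul_zero, mul_zero]

open Classical in
/-- The bounded operator which is diagonal in the Hilbert basis `b`, with bounded eigenvalues `f`
(and `0` if `f` is unbounded). -/
noncomputable def diag (b : HilbertBasis ι ℂ H) (f : ι → ℝ) : H →L[ℂ] H :=
  if h : ∃ T : H →L[ℂ] H, ∀ i, T (b i) = (f i : ℂ) • b i then h.choose else 0

variable {b : HilbertBasis ι ℂ H} {b' : HilbertBasis κ ℂ H} {f g : ι → ℝ}

theorem BddFun.exists_nonneg (hf : BddFun f) : ∃ C : ℝ, 0 ≤ C ∧ ∀ i, |f i| ≤ C := by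
  obtain ⟨C, hC⟩ := hf
  exact ⟨|C|, abs_nonneg _, fun i => (hC i).trans (le_abs_self C)⟩

theorem diag_apply (b : HilbertBasis ι ℂ H) (hf : BddFun f) (i : ι) :
    diag b f (b i) = (f i : ℂ) • b i := by
  obtain ⟨C, hC, h⟩ := hf.exists_nonneg
  have hex : ∃ T : H →L[ℂ] H, ∀ i, T (b i) = (f i : ℂ) • b i :=
    (exists_diagonal b hC h).imp fun T hT => hT.1
  rw [diag, dif_pos hex]
  exact hex.choose_spec i

theorem norm_diag_le (b : HilbertBasis ι ℂ H) {C : ℝ} (hC : 0 ≤ C) (h : ∀ i, |f i| ≤ C) :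
    ‖diag b f‖ ≤ C := by
  obtain ⟨T, hT, hle⟩ := exists_diagonal b hC h
  rwa [← clm_ext_basis b fun i => (hT i).trans (diag_apply b ⟨C, h⟩ i).symm]

theorem BddFun.mul (hf : BddFun f) (hg : BddFun g) : BddFun (f * g) := by
  obtain ⟨C, hC, h⟩ := hf.exists_nonneg
  obtain ⟨C', hC', h'⟩ := hg.exists_nonneg
  refine ⟨C * C', fun i => ?_⟩
  rw [Pi.mul_apply, abs_mul]
  exact mul_le_mul (h i) (h' i) (abs_nonneg _) hC

theorem BddFun.add (hf : BddFun f) (hg : BddFun g) : BddFun (f + g) := by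
  obtain ⟨C, h⟩ := hf
  obtain ⟨C', h'⟩ := hg
  exact ⟨C + C', fun i => (abs_add_le _ _).trans (add_le_add (h i) (h' i))⟩

theorem bddFun_indicator_one (s : Set ι) : BddFun (s.indicator (1 : ι → ℝ)) :=
  ⟨1, fun i => by by_cases h : i ∈ s <;> simp [h]⟩

theorem BddFun.indicator (hf : BddFun f) (s : Set ι) : BddFun (s.indicator f) := by
  obtain ⟨C, hC, h⟩ := hf.exists_nonneg
  exact ⟨C, fun i => by by_cases hi : i ∈ s <;> simp [hi, h, hC]⟩

theorem bddFun_indicator_finite {s : Set ι} (hs : s.Finite) (f : ι → ℝ) :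
    BddFun (s.indicator f) := by
  obtain ⟨C, hC⟩ := (hs.image fun i => |f i|).bddAbove
  refine ⟨|C|, fun i => ?_⟩
  by_cases hi : i ∈ s
  · rw [Set.indicator_of_mem hi]
    exact (hC (Set.mem_image_of_mem _ hi)).trans (le_abs_self C)
  · rw [Set.indicator_of_notMem hi, abs_zero]
    exact abs_nonneg C

theorem diag_mul_diag (b : HilbertBasis ι ℂ H) (hf : BddFun f) (hg : BddFun g) :
    diag b f * diag b g = diag b (f * g) := by
  refine clm_ext_basis b fun i => ?_
  rw [diag_apply b (hf.mul hg)]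
  change diag b f (diag b g (b i)) = _
  rw [diag_apply b hg, map_smul, diag_apply b hf, smul_smul, Pi.mul_apply, mul_comm,
    Complex.ofReal_mul]

theorem diag_add (b : HilbertBasis ι ℂ H) (hf : BddFun f) (hg : BddFun g) :
    diag b f + diag b g = diag b (f + g) := by
  refine clm_ext_basis b fun i => ?_
  rw [diag_apply b (hf.add hg), _root_.add_apply, diag_apply b hf, diag_apply b hg, ← add_smul,
    Pi.add_apply, Complex.ofReal_add]

theorem inner_basis_eq (b : HilbertBasis ι ℂ H) {i j : ι} (h : i ≠ j) :
    inner ℂ (b i) (b j) = (0 : ℂ) := b.orthonormal.2 h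

theorem inner_diag (b : HilbertBasis ι ℂ H) (hf : BddFun f) (i : ι) (x : H) :
    inner ℂ (b i) (diag b f x) = (f i : ℂ) * inner ℂ (b i) x := by
  have h : innerSL ℂ (b i) ∘L diag b f = (f i : ℂ) • innerSL ℂ (b i) := by
    refine clm_ext_basis b fun j => ?_
    simp only [comp_apply, innerSL_apply_apply, _root_.smul_apply, diag_apply b hf,
      inner_smul_right, smul_eq_mul]
    rcases eq_or_ne i j with rfl | hij
    · rfl
    · rw [inner_basis_eq b hij, mul_zero, mul_zero]
  exact congrArg (fun A : H →L[ℂ] ℂ => A x) h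

theorem isSelfAdjoint_diag (b : HilbertBasis ι ℂ H) (hf : BddFun f) :
    IsSelfAdjoint (diag b f) := by
  rw [isSelfAdjoint_iff_isSymmetric]
  intro x y
  change inner ℂ (diag b f x) y = inner ℂ x (diag b f y)
  rw [← b.tsum_inner_mul_inner, ← b.tsum_inner_mul_inner x]
  refine tsum_congr fun i => ?_
  rw [inner_diag b hf, ← inner_conj_symm, inner_diag b hf, map_mul, Complex.conj_ofReal,
    inner_conj_symm]
  ring

theorem rank_diag_le (b : HilbertBasis ι ℂ H) {s : Finset ι} (hs : ∀ i ∉ s, f i = 0) :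
    LinearMap.rank (diag b f : H →ₗ[ℂ] H) ≤ s.card := by
  classical
  have hf : BddFun f := by
    have h1 := bddFun_indicator_finite s.finite_toSet f
    rwa [Set.indicator_eq_self.mpr] at h1
    intro i hi
    by_contra h
    exact hi (hs i h)
  set V : Submodule ℂ H := Submodule.span ℂ (s.image b : Set H) with hV
  have hVfin : FiniteDimensional ℂ V := FiniteDimensional.span_of_finite ℂ (Finset.finite_toSet _)
  have hrange : LinearMap.range (diag b f : H →ₗ[ℂ] H) ≤ V := by
    have heq : V.starProjection ∘L diag b f = diag b f := by
      refine clm_ext_basis b fun i => ?_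
      rw [comp_apply, diag_apply b hf, map_smul]
      by_cases hi : i ∈ s
      · rw [Submodule.starProjection_eq_self_iff.mpr]
        exact Submodule.subset_span (by simpa using ⟨i, hi, rfl⟩)
      · simp [hs i hi]
    rintro _ ⟨x, rfl⟩
    change diag b f x ∈ V
    rw [← heq]
    exact Submodule.starProjection_apply_mem V _
  refine (Submodule.rank_mono hrange).trans ((rank_span_finset_le _).trans ?_)
  exact_mod_cast Finset.card_image_le

theorem hasSum_re_inner_diag (b : HilbertBasis ι ℂ H) (hf : BddFun f) (x : H) :
    HasSum (fun i => f i * ‖inner ℂ (b i) x‖ ^ 2) (inner ℂ x (diag b f x)).re := by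
  have h := Complex.hasSum_re (b.hasSum_inner_mul_inner x (diag b f x))
  convert h using 2 with i
  rw [inner_diag b hf, ← inner_conj_symm (b i) x, mul_left_comm, Complex.mul_conj',
    Complex.re_ofReal_mul, RCLike.norm_conj]
  norm_cast

end Diagonal

/-! ### Comparison of the inverse absolute values of `D` and `D + M` -/

section Perturbation

variable {H : Type*} [NormedAddCommGroup H] [InnerProductSpace ℂ H] [CompleteSpace H]
variable {ι κ : Type*} {b : HilbertBasis ι ℂ H} {b' : HilbertBasis κ ℂ H} {l : ι → ℝ} {m : κ → ℝ}
  {M : H →L[ℂ] H}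

/-- The operators with eigenvalues `l` in `b` and `m` in `b'` differ by the bounded operator `M`. -/
def Intertwines (b : HilbertBasis ι ℂ H) (b' : HilbertBasis κ ℂ H) (l : ι → ℝ) (m : κ → ℝ)
    (M : H →L[ℂ] H) : Prop :=
  ∀ i j, inner ℂ (b' j) (M (b i)) = ((m j : ℂ) - l i) * inner ℂ (b' j) (b i)

theorem Intertwines.neg (h : Intertwines b b' l m M) :
    Intertwines b b' (fun i => -l i) (fun j => -m j) (-M) := fun i j => by
  rw [_root_.neg_apply, inner_neg_right, h i j]
  push_cast
  ring

/-- The orthogonal projection onto the closed span of the basis vectors with indices in `s`. -/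
noncomputable def basisProj (b : HilbertBasis ι ℂ H) (s : Set ι) : H →L[ℂ] H :=
  diag b (s.indicator 1)

theorem basisProj_mul_diag (s : Set ι) {f : ι → ℝ} (hf : BddFun f) :
    basisProj b s * diag b f = diag b (s.indicator f) := by
  rw [basisProj, diag_mul_diag b (bddFun_indicator_one s) hf]
  congr 1
  ext i
  by_cases hi : i ∈ s <;> simp [hi]

theorem basisProj_mul_basisProj (s t : Set ι) :
    basisProj b s * basisProj b t = basisProj b (s ∩ t) := by
  rw [basisProj, basisProj, diag_mul_diag b (bddFun_indicator_one s) (bddFun_indicator_one t),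
    basisProj, Set.inter_indicator_one]

theorem isSelfAdjoint_basisProj (b : HilbertBasis ι ℂ H) (s : Set ι) :
    IsSelfAdjoint (basisProj b s) :=
  isSelfAdjoint_diag b (bddFun_indicator_one s)

theorem inner_basisProj_left (b : HilbertBasis ι ℂ H) (s : Set ι) (x y : H) :
    inner ℂ (basisProj b s x) y = inner ℂ x (basisProj b s y) :=
  (isSelfAdjoint_basisProj b s).isSymmetric x y

theorem basisProj_apply_idem (s : Set ι) (x : H) :
    basisProj b s (basisProj b s x) = basisProj b s x := by
  have h := basisProj_mul_basisProj (b := b) s s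
  rw [Set.inter_self] at h
  exact congrArg (fun T : H →L[ℂ] H => T x) h

theorem isPositive_basisProj (b : HilbertBasis ι ℂ H) (s : Set ι) :
    (basisProj b s).IsPositive := by
  have h := ContinuousLinearMap.isPositive_one (𝕜 := ℂ) (E := H) |>.conj_adjoint (basisProj b s)
  rw [(isSelfAdjoint_basisProj b s).adjoint_eq] at h
  convert h using 1
  ext x
  exact (basisProj_apply_idem s x).symm

/-- Finiteness of `J` makes the restriction of `D` bounded, so the relation `D = (D + M) - M`
extends from basis vectors to every vector. -/
theorem inner_left_diag_eq (h : Intertwines b b' l m M) {J : Set ι} (hJ : J.Finite) (j : κ)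
    (x : H) : inner ℂ (b' j) (diag b (J.indicator l) x) =
      (m j : ℂ) * inner ℂ (b' j) (basisProj b J x) - inner ℂ (b' j) (M (basisProj b J x)) := by
  have hclm : innerSL ℂ (b' j) ∘L diag b (J.indicator l) =
      (m j : ℂ) • (innerSL ℂ (b' j) ∘L basisProj b J) -
        innerSL ℂ (b' j) ∘L (M ∘L basisProj b J) := by
    refine clm_ext_basis b fun i => ?_
    simp only [comp_apply, innerSL_apply_apply, _root_.smul_apply, _root_.sub_apply, smul_eq_mul,
      basisProj, diag_apply b (bddFun_indicator_finite hJ l),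
      diag_apply b (bddFun_indicator_one J)]
    by_cases hi : i ∈ J
    · simp only [Set.indicator_of_mem hi, Pi.one_apply, Complex.ofReal_one, one_smul, h i j,
        inner_smul_right]
      ring
    · simp [hi]
  exact congrArg (fun A : H →L[ℂ] ℂ => A x) hclm

/-- The positive spectral subspace of the perturbed operator is almost orthogonal to the spectral
subspace of the unperturbed operator for `(-∞, -t]`: finitely many eigenvectors. -/
theorem norm_basisProj_mul_basisProj_le_of_finite (h : Intertwines b b' l m M) {t : ℝ}
    (ht : 0 < t) {J : Set ι} (hJ : J.Finite) (hl : ∀ i ∈ J, l i ≤ -t) :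
    ‖basisProj b' {j | 0 < m j} * basisProj b J‖ ≤ ‖M‖ / t := by
  set P := basisProj b' {j | 0 < m j} with hP
  set Q := basisProj b J with hQ
  -- Its norm is `‖P Q‖²`, and finite rank ensures that this is attained at a unit eigenvector `v =
  -- Q v`. Below, `w` stands for `D v`.
  set B : H →L[ℂ] H := Q ∘L P ∘L Q with hB
  have hQQ : ∀ x, Q (Q x) = Q x := basisProj_apply_idem J
  have hPP : ∀ x, P (P x) = P x := basisProj_apply_idem _
  have hQs : ∀ x y, inner ℂ (Q x) y = inner ℂ x (Q y) := inner_basisProj_left b J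
  have hPs : ∀ x y, inner ℂ (P x) y = inner ℂ x (P y) := inner_basisProj_left b' _
  have hnorm : ‖P * Q‖ * ‖P * Q‖ = ‖B‖ := by
    rw [← CStarRing.norm_star_mul_self]
    congr 1
    rw [star_mul, (isSelfAdjoint_basisProj b' _).star_eq, (isSelfAdjoint_basisProj b _).star_eq]
    ext x
    change Q (P (P (Q x))) = Q (P (Q x))
    rw [hPP]
  have hBpos : B.IsPositive := by
    have h1 := (isPositive_basisProj b' {j | 0 < m j}).conj_adjoint Q
    rwa [(isSelfAdjoint_basisProj b J).adjoint_eq] at h1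
  have hBc : IsCompactOperator B := by
    have h1 : LinearMap.rank (B : H →ₗ[ℂ] H) ≤ hJ.toFinset.card := by
      refine (LinearMap.rank_comp_le_left _ _).trans (rank_diag_le b fun i hi => ?_)
      exact Set.indicator_of_notMem (by simpa using hi) _
    exact isCompactOperator_of_tendsto_singularValue
      ((weakClass_of_rank_lt zero_le_one h1).tendsto_singularValue zero_lt_one)
  rcases eq_or_ne B 0 with h0 | h0
  · rw [h0, norm_zero, mul_self_eq_zero] at hnorm
    rw [hnorm]
    positivity
  obtain ⟨v, hv, hBv⟩ := exists_apply_eq_norm_smul hBpos hBc h0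
  have hB0 : (‖B‖ : ℂ) ≠ 0 := by simpa using h0
  have hQv : Q v = v := by
    refine smul_right_injective H hB0 ?_
    change (‖B‖ : ℂ) • Q v = (‖B‖ : ℂ) • v
    rw [← map_smul, ← hBv]
    exact hQQ _
  have hJb := bddFun_indicator_finite hJ l
  set w := diag b (J.indicator l) v with hw
  have hQw : Q w = w := by
    have h1 := basisProj_mul_diag (b := b) J hJb
    rw [Set.indicator_indicator, Set.inter_self] at h1
    exact congrArg (fun T : H →L[ℂ] H => T v) h1
  have hBval : ∀ y, inner ℂ (B v) y = inner ℂ (P v) (Q y) := fun y => by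
    change inner ℂ (Q (P (Q v))) y = _
    rw [hQv, hQs]
  have hPv : ‖P v‖ = ‖P * Q‖ := by
    have h1 := hBval v
    rw [hBv, inner_smul_left, inner_self_eq_norm_sq_to_K, hv, hQv, ← hPP, hPs,
      inner_self_eq_norm_sq_to_K] at h1
    have h2 : ‖B‖ = ‖P v‖ ^ 2 := by
      simp only [Complex.conj_ofReal, Complex.coe_algebraMap, Complex.ofReal_one, one_pow,
        mul_one] at h1
      exact_mod_cast h1
    rw [← hnorm, ← pow_two] at h2
    exact ((pow_left_inj₀ (norm_nonneg _) (norm_nonneg _) two_ne_zero).mp h2).symm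
  have hneg : (inner ℂ v w).re ≤ -t := by
    have h1 := hasSum_re_inner_diag b hJb v
    have h2 := (hasSum_re_inner_diag b (bddFun_indicator_one J) v).mul_left (-t)
    have h3 := hasSum_le (fun i => ?_) h1 h2
    · change (inner ℂ v w).re ≤ -t * (inner ℂ v (Q v)).re at h3
      rw [hQv, inner_self_eq_norm_sq_to_K, hv] at h3
      simpa using h3
    · rw [← mul_assoc]
      refine mul_le_mul_of_nonneg_right ?_ (by positivity)
      by_cases hi : i ∈ J
      · simpa [hi] using hl i hi
      · simp [hi]
  -- Here `w + M v = (D + M) v` and `P` is the positive spectral projection of `D + M`.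
  have hkey : 0 ≤ (inner ℂ (P v) (w + M v)).re := by
    have h1 : ∀ j, inner ℂ (b' j) (w + M v) = (m j : ℂ) * inner ℂ (b' j) v := fun j => by
      have h2 := inner_left_diag_eq h hJ j v
      rw [← hQ, hQv] at h2
      rw [inner_add_right, hw, h2]
      ring
    have h2 := Complex.hasSum_re (b'.hasSum_inner_mul_inner (P v) (w + M v))
    refine h2.nonneg fun j => ?_
    rw [h1, ← inner_conj_symm, hP, basisProj, inner_diag b' (bddFun_indicator_one _), map_mul,
      Complex.conj_ofReal, mul_mul_mul_comm, Complex.conj_mul', ← Complex.ofReal_mul,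
      Complex.re_ofReal_mul]
    refine mul_nonneg ?_ (by norm_cast; positivity)
    by_cases hj : 0 < m j
    · simpa [hj] using hj.le
    · simp [hj]
  have hcs : (inner ℂ (P v) (M v)).re ≤ ‖P * Q‖ * ‖M‖ := by
    refine (Complex.re_le_norm _).trans ((norm_inner_le_norm _ _).trans ?_)
    rw [hPv]
    refine mul_le_mul_of_nonneg_left ?_ (norm_nonneg _)
    simpa [hv] using M.le_opNorm v
  -- Since `v` is an eigenvector of `B`, `⟨P v, D v⟩ = ⟨B v, D v⟩ = ‖B‖ ⟨v, D v⟩`. With `s = ‖P Q‖`,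
  -- this and the two bounds above give `t s² ≤ s ‖M‖`.
  have hmain : (inner ℂ (P v) w).re ≤ ‖B‖ * (-t) := by
    have h1 := hBval w
    rw [hQw, hBv, inner_smul_left, Complex.conj_ofReal] at h1
    rw [← h1, Complex.re_ofReal_mul]
    exact mul_le_mul_of_nonneg_left hneg (norm_nonneg _)
  rw [inner_add_right, Complex.add_re] at hkey
  have hs : 0 < ‖P * Q‖ := by
    refine (norm_nonneg _).lt_of_ne' fun h1 => h0 ?_
    rw [h1, zero_mul] at hnorm
    exact norm_eq_zero.mp hnorm.symm
  rw [le_div_iff₀ ht]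
  refine le_of_mul_le_mul_left ?_ hs
  nlinarith

theorem tendsto_basisProj (b : HilbertBasis ι ℂ H) (x : H) :
    Filter.Tendsto (fun s : Finset ι => basisProj b (s : Set ι) x) Filter.atTop (𝓝 x) := by
  have h := b.hasSum_repr x
  refine Filter.Tendsto.congr (fun s => ?_) h
  refine ext_inner_basis b fun i => ?_
  classical
  rw [basisProj, inner_diag b (bddFun_indicator_one _), inner_sum]
  simp only [inner_smul_right, b.repr_apply_apply]
  by_cases hi : i ∈ s
  · rw [Finset.sum_eq_single i]
    · rw [inner_self_eq_norm_sq_to_K, b.orthonormal.1 i]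
      simp [hi]
    · intro j _ hji
      rw [inner_basis_eq b hji.symm, mul_zero]
    · exact fun h => absurd hi h
  · rw [Finset.sum_eq_zero]
    · simp [hi]
    · intro j hj
      rw [inner_basis_eq b (by rintro rfl; exact hi hj), mul_zero]

/-- The bound for finite index sets does not depend on the set, so it passes to the strong limit
along `J ∩ s`. -/
theorem norm_basisProj_mul_basisProj_le (h : Intertwines b b' l m M) {t : ℝ}
    (ht : 0 < t) {J : Set ι} (hl : ∀ i ∈ J, l i ≤ -t) :
    ‖basisProj b' {j | 0 < m j} * basisProj b J‖ ≤ ‖M‖ / t := by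
  refine ContinuousLinearMap.opNorm_le_bound _ (by positivity) fun x => ?_
  have hlim := ((basisProj b' {j | 0 < m j} * basisProj b J).continuous.tendsto x).comp
    (tendsto_basisProj b x)
  refine le_of_tendsto hlim.norm (Filter.Eventually.of_forall fun s => ?_)
  have h1 := norm_basisProj_mul_basisProj_le_of_finite h ht (J := J ∩ s)
    (s.finite_toSet.inter_of_right J) fun i hi => hl i hi.1
  rw [← basisProj_mul_basisProj, ← mul_assoc] at h1
  exact (ContinuousLinearMap.le_opNorm _ x).trans (mul_le_mul_of_nonneg_right h1 (norm_nonneg x))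

/-- The eigenvalues `l` grow at least like `k ^ a`. -/
def EigenvalueGrowth (l : ι → ℝ) (a : ℝ) : Prop :=
  ∃ c : ℝ, 0 < c ∧ ∃ k₀ : ℕ, ∀ k : ℕ, k₀ ≤ k →
    ∃ s : Finset ι, s.card ≤ k ∧ ∀ i ∉ s, c * ((k : ℝ) + 1) ^ a ≤ |l i|

theorem EigenvalueGrowth.neg {a : ℝ} (h : EigenvalueGrowth l a) :
    EigenvalueGrowth (fun i => -l i) a := by
  simpa only [EigenvalueGrowth, abs_neg] using h

theorem bddFun_inv (hfin : ∀ t : ℝ, {i | |l i| ≤ t}.Finite) : BddFun fun i => (l i)⁻¹ := by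
  obtain ⟨C, hC, h⟩ := (bddFun_indicator_finite (hfin 1) fun i => (l i)⁻¹).exists_nonneg
  refine ⟨max C 1, fun i => ?_⟩
  rcases le_or_gt |l i| 1 with hi | hi
  · have h1 := h i
    rw [Set.indicator_of_mem (show i ∈ {i | |l i| ≤ 1} from hi)] at h1
    exact h1.trans (le_max_left _ _)
  · rw [abs_inv]
    exact (inv_le_one_of_one_le₀ hi.le).trans (le_max_right _ _)

theorem bddFun_abs_inv (hfin : ∀ t : ℝ, {i | |l i| ≤ t}.Finite) : BddFun fun i => |l i|⁻¹ := by
  obtain ⟨C, hC⟩ := bddFun_inv hfin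
  exact ⟨C, fun i => by simpa only [abs_inv, abs_abs] using hC i⟩

theorem weakClass_diag_abs_inv {a : ℝ} (ha : 0 ≤ a)
    (hfin : ∀ t : ℝ, {i | |l i| ≤ t}.Finite) (hg : EigenvalueGrowth l a) :
    WeakClass a (diag b fun i => |l i|⁻¹) := by
  obtain ⟨c, hc, k₀, h⟩ := hg
  refine weakClass_of_eventually (C := c⁻¹) (k₀ := k₀) ha (by positivity) fun k hk => ?_
  obtain ⟨s, hs, hsl⟩ := h k hk
  have hb := bddFun_abs_inv hfin
  have hpos : 0 < c * ((k : ℝ) + 1) ^ a := by positivity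
  have hrank : LinearMap.rank
      (diag b ((s : Set ι).indicator fun i => |l i|⁻¹) : H →ₗ[ℂ] H) ≤ k :=
    (rank_diag_le b fun i hi => Set.indicator_of_notMem (by simpa using hi) _).trans
      (mod_cast hs)
  refine (singularValue_le hrank).trans ?_
  have hsplit : diag b (fun i => |l i|⁻¹) - diag b ((s : Set ι).indicator fun i => |l i|⁻¹) =
      diag b ((s : Set ι)ᶜ.indicator fun i => |l i|⁻¹) := by
    rw [sub_eq_iff_eq_add, diag_add b (hb.indicator _) (hb.indicator _),
      Set.indicator_compl_add_self]
  rw [hsplit, Real.rpow_neg (by positivity), ← mul_inv]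
  refine norm_diag_le b (by positivity) fun i => ?_
  by_cases hi : i ∈ s
  · simp only [Set.mem_compl_iff, Finset.mem_coe, hi, not_true_eq_false, not_false_eq_true,
      Set.indicator_of_notMem, abs_zero]
    positivity
  · simp only [Set.mem_compl_iff, Finset.mem_coe, hi, not_false_eq_true, Set.indicator_of_mem,
      abs_inv, abs_abs]
    exact inv_anti₀ hpos (hsl i hi)

/-- Discarding at most `k` eigenvectors leaves only eigenvalues with `|l i| ≥ t`, where `t` is of
order `k ^ a`. The remainder has norm at most `‖M‖ / t` from the overlap of spectral subspaces,
times `1 / t` from the inverse. -/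
theorem weakClass_basisProj_mul_diag {a : ℝ} (ha : 0 ≤ a) (hrel : Intertwines b b' l m M)
    (hfin : ∀ t : ℝ, {i | |l i| ≤ t}.Finite) (hg : EigenvalueGrowth l a) :
    WeakClass (a + a) (basisProj b' {j | 0 < m j} *
      diag b ({i | l i < 0}.indicator fun i => |l i|⁻¹)) := by
  obtain ⟨c, hc, k₀, h⟩ := hg
  refine weakClass_of_eventually (C := ‖M‖ * (c⁻¹ * c⁻¹)) (k₀ := k₀) (by positivity)
    (by positivity) fun k hk => ?_
  obtain ⟨s, hs, hsl⟩ := h k hk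
  set F : ι → ℝ := {i | l i < 0}.indicator fun i => |l i|⁻¹ with hF
  have hb : BddFun F := (bddFun_abs_inv hfin).indicator _
  set t := c * ((k : ℝ) + 1) ^ a with ht
  have hpos : 0 < t := by positivity
  have hrank : LinearMap.rank
      ((basisProj b' {j | 0 < m j} * diag b ((s : Set ι).indicator F) : H →L[ℂ] H) :
        H →ₗ[ℂ] H) ≤ k :=
    (LinearMap.rank_comp_le_right _ _).trans
      ((rank_diag_le b fun i hi => Set.indicator_of_notMem (by simpa using hi) _).trans
        (mod_cast hs))
  refine (singularValue_le hrank).trans ?_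
  set J : Set ι := {i | l i < 0 ∧ i ∉ s} with hJ
  have hsplit : diag b F - diag b ((s : Set ι).indicator F) =
      basisProj b J * diag b ((s : Set ι)ᶜ.indicator F) := by
    rw [basisProj_mul_diag J (hb.indicator _), sub_eq_iff_eq_add,
      diag_add b ((hb.indicator _).indicator _) (hb.indicator _)]
    congr 1
    ext i
    by_cases hi : i ∈ s <;> by_cases hi' : l i < 0 <;> simp [hi, hi', hF, hJ]
  rw [← mul_sub, hsplit, ← mul_assoc]
  refine (norm_mul_le _ _).trans ?_
  have h1 : ‖basisProj b' {j | 0 < m j} * basisProj b J‖ ≤ ‖M‖ / t := by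
    refine norm_basisProj_mul_basisProj_le hrel hpos fun i hi => ?_
    have h2 := hsl i hi.2
    rw [abs_of_neg hi.1] at h2
    linarith
  have h2 : ‖diag b ((s : Set ι)ᶜ.indicator F)‖ ≤ t⁻¹ := by
    refine norm_diag_le b (by positivity) fun i => ?_
    by_cases hi : i ∈ s
    · simp [hi]
      positivity
    · by_cases hi' : l i < 0
      · simp only [Set.mem_compl_iff, Finset.mem_coe, hi, not_false_eq_true,
          Set.indicator_of_mem, hF, Set.mem_ofPred_eq, hi', abs_inv, abs_abs]
        exact inv_anti₀ hpos (hsl i hi)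
      · simp [hi, hF, hi']
        positivity
  refine (mul_le_mul h1 h2 (norm_nonneg _) (by positivity)).trans_eq ?_
  rw [neg_add, Real.rpow_add (by positivity), Real.rpow_neg (by positivity), ht]
  field_simp

theorem weakClass_basisProj_mul_diag' {a : ℝ} (ha : 0 ≤ a) (hrel : Intertwines b b' l m M)
    (hfin : ∀ t : ℝ, {i | |l i| ≤ t}.Finite) (hg : EigenvalueGrowth l a) :
    WeakClass (a + a) (basisProj b' {j | m j < 0} *
      diag b ({i | 0 < l i}.indicator fun i => |l i|⁻¹)) := by
  have h := weakClass_basisProj_mul_diag ha hrel.neg (by simpa using hfin) hg.neg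
  simpa using h

theorem finite_zeros (hfin : ∀ t : ℝ, {i | |l i| ≤ t}.Finite) : {i | l i = 0}.Finite :=
  (hfin 0).subset fun i hi => by simp_all

theorem weakClass_basisProj_of_finite (b : HilbertBasis ι ℂ H) {a : ℝ} (ha : 0 ≤ a) {s : Set ι}
    (hs : s.Finite) : WeakClass a (basisProj b s) :=
  weakClass_of_rank_lt ha (rank_diag_le b (s := hs.toFinset) fun i hi =>
    Set.indicator_of_notMem (by simpa using hi) _)

theorem bddFun_sign (l : ι → ℝ) : BddFun fun i => Real.sign (l i) :=
  ⟨1, fun i => by rcases Real.sign_apply_eq (l i) with h | h | h <;> simp [h]⟩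

theorem sign_mul_inv (x : ℝ) : Real.sign x * x⁻¹ = |x|⁻¹ := by
  rcases lt_trichotomy x 0 with h | rfl | h
  · rw [Real.sign_of_neg h, abs_of_neg h, inv_neg, neg_one_mul]
  · simp
  · rw [Real.sign_of_pos h, abs_of_pos h, one_mul]

theorem sign_mul_abs_inv (x : ℝ) : Real.sign x * |x|⁻¹ = x⁻¹ := by
  rcases lt_trichotomy x 0 with h | rfl | h
  · rw [Real.sign_of_neg h, abs_of_neg h, inv_neg, neg_one_mul, neg_neg]
  · simp
  · rw [Real.sign_of_pos h, abs_of_pos h, one_mul]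

theorem diag_sign_mul_diag_inv (b : HilbertBasis ι ℂ H)
    (hfin : ∀ t : ℝ, {i | |l i| ≤ t}.Finite) :
    diag b (fun i => Real.sign (l i)) * diag b (fun i => (l i)⁻¹) = diag b fun i => |l i|⁻¹ := by
  rw [diag_mul_diag b (bddFun_sign l) (bddFun_inv hfin)]
  congr 1
  ext i
  exact sign_mul_inv (l i)

theorem diag_sign_mul_diag_abs_inv (b : HilbertBasis ι ℂ H)
    (hfin : ∀ t : ℝ, {i | |l i| ≤ t}.Finite) :
    diag b (fun i => Real.sign (l i)) * diag b (fun i => |l i|⁻¹) = diag b fun i => (l i)⁻¹ := by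
  rw [diag_mul_diag b (bddFun_sign l) (bddFun_abs_inv hfin)]
  congr 1
  ext i
  exact sign_mul_abs_inv (l i)

theorem inner_diag_mul_mul_diag {f : κ → ℝ} {g : ι → ℝ} (hf : BddFun f) (hg : BddFun g)
    (A : H →L[ℂ] H) (i : ι) (j : κ) :
    inner ℂ (b' j) ((diag b' f * A * diag b g) (b i)) =
      (f j : ℂ) * g i * inner ℂ (b' j) (A (b i)) := by
  change inner ℂ (b' j) (diag b' f (A (diag b g (b i)))) = _
  rw [inner_diag b' hf, diag_apply b hg, map_smul, inner_smul_right, mul_assoc]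

/-- The second resolvent identity at `0`, up to the kernels. -/
theorem diag_inv_sub_diag_inv (hrel : Intertwines b b' l m M)
    (hfin : ∀ t : ℝ, {i | |l i| ≤ t}.Finite) (hfin' : ∀ t : ℝ, {j | |m j| ≤ t}.Finite) :
    diag b' (fun j => (m j)⁻¹) - diag b (fun i => (l i)⁻¹) =
      diag b' (fun j => (m j)⁻¹) * basisProj b {i | l i = 0} -
        basisProj b' {j | m j = 0} * diag b (fun i => (l i)⁻¹) -
        diag b' (fun j => (m j)⁻¹) * M * diag b (fun i => (l i)⁻¹) := by
  have hb := bddFun_inv hfin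
  have hb' := bddFun_inv hfin'
  refine clm_ext_inner_basis b b' fun i j => ?_
  simp only [_root_.sub_apply, inner_sub_right, inner_diag_mul_mul_diag hb' hb, hrel i j]
  change inner ℂ (b' j) (diag b' _ (b i)) - inner ℂ (b' j) (diag b _ (b i)) =
    inner ℂ (b' j) (diag b' _ (diag b _ (b i))) - inner ℂ (b' j) (diag b' _ (diag b _ (b i))) - _
  rw [inner_diag b' hb', inner_diag b' hb', inner_diag b' (bddFun_indicator_one _),
    diag_apply b hb, diag_apply b (bddFun_indicator_one _), inner_smul_right, inner_smul_right]
  by_cases hi : l i = 0 <;> by_cases hj : m j = 0 <;>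
    simp only [hi, hj, Set.indicator, Set.mem_ofPred_eq, if_true, if_false, Pi.one_apply] <;>
    push_cast
  · simp
  · simp
  · simp
  · have hi' : (l i : ℂ) ≠ 0 := by exact_mod_cast hi
    have hj' : (m j : ℂ) ≠ 0 := by exact_mod_cast hj
    field_simp
    ring

/-- The matrix coefficient carries the factor `(sign (m j) - sign (l i)) / l i`. It vanishes for
equal signs, is `-2 / |l i|` for opposite signs, and is `-1 / |l i|` when only `m j` vanishes. -/
theorem diag_sign_sub_mul (hfin : ∀ t : ℝ, {i | |l i| ≤ t}.Finite) :
    (diag b' (fun j => Real.sign (m j)) - diag b (fun i => Real.sign (l i))) *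
        diag b (fun i => (l i)⁻¹) =
      (-2 : ℂ) • (basisProj b' {j | 0 < m j} *
        diag b ({i | l i < 0}.indicator fun i => |l i|⁻¹)) +
      (-2 : ℂ) • (basisProj b' {j | m j < 0} *
        diag b ({i | 0 < l i}.indicator fun i => |l i|⁻¹)) -
      basisProj b' {j | m j = 0} * diag b (fun i => |l i|⁻¹) := by
  have hb := bddFun_inv hfin
  have hb' := bddFun_abs_inv hfin
  rw [sub_mul, diag_sign_mul_diag_inv b hfin]
  refine clm_ext_inner_basis b b' fun i j => ?_
  simp only [_root_.sub_apply, _root_.add_apply, _root_.smul_apply, inner_sub_right,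
    inner_add_right, inner_smul_right]
  change inner ℂ (b' j) (diag b' _ (diag b _ (b i))) - inner ℂ (b' j) (diag b _ (b i)) =
    -2 * inner ℂ (b' j) (diag b' _ (diag b _ (b i))) +
    -2 * inner ℂ (b' j) (diag b' _ (diag b _ (b i))) - inner ℂ (b' j) (diag b' _ (diag b _ (b i)))
  simp only [inner_diag b' (bddFun_sign m), inner_diag b' (bddFun_indicator_one _),
    diag_apply b hb, diag_apply b hb', diag_apply b (hb'.indicator _), inner_smul_right]
  have key : ∀ x : ℝ, (x < 0 ∧ ¬ 0 < x ∧ x ≠ 0 ∧ |x| = -x ∧ Real.sign x = -1) ∨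
      (¬ x < 0 ∧ ¬ 0 < x ∧ x = 0 ∧ |x| = 0 ∧ Real.sign x = 0) ∨
      (¬ x < 0 ∧ 0 < x ∧ x ≠ 0 ∧ |x| = x ∧ Real.sign x = 1) := fun x => by
    rcases lt_trichotomy x 0 with h | rfl | h
    · exact Or.inl ⟨h, h.not_gt, h.ne, abs_of_neg h, Real.sign_of_neg h⟩
    · exact Or.inr (Or.inl (by simp))
    · exact Or.inr (Or.inr ⟨h.not_gt, h, h.ne', abs_of_pos h, Real.sign_of_pos h⟩)
  simp only [Set.indicator, Set.mem_ofPred_eq, Pi.one_apply]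
  rcases key (l i) with ⟨h1, h2, h3, h4, -⟩ | ⟨h1, h2, h3, h4, -⟩ | ⟨h1, h2, h3, h4, -⟩ <;>
    rcases key (m j) with ⟨k1, k2, k3, -, k5⟩ | ⟨k1, k2, k3, -, k5⟩ | ⟨k1, k2, k3, -, k5⟩ <;>
    simp only [h1, h2, h3, h4, k1, k2, k3, k5, if_true, if_false, inv_neg,
      lt_self_iff_false, Real.sign_zero, inv_zero] <;> push_cast <;>
    first | ring1 | simp

/-- `|D + M|⁻¹ - |D|⁻¹` has singular values of the order of those of `|D|⁻²`. -/
theorem weakClass_diag_abs_inv_sub {a : ℝ} (ha : 0 ≤ a) (hrel : Intertwines b b' l m M)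
    (hfin : ∀ t : ℝ, {i | |l i| ≤ t}.Finite) (hfin' : ∀ t : ℝ, {j | |m j| ≤ t}.Finite)
    (hg : EigenvalueGrowth l a) :
    WeakClass (a + a) (diag b' (fun j => |m j|⁻¹) - diag b (fun i => |l i|⁻¹)) := by
  have haa : 0 ≤ a + a := add_nonneg ha ha
  set N := diag b (fun i => |l i|⁻¹) with hN
  set G := diag b (fun i => (l i)⁻¹) with hG
  set G' := diag b' (fun j => (m j)⁻¹) with hG'
  set F := diag b (fun i => Real.sign (l i)) with hF
  set F' := diag b' (fun j => Real.sign (m j)) with hF'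
  have hNw : WeakClass a N := weakClass_diag_abs_inv ha hfin hg
  have hGw : WeakClass a G := by
    rw [hG, ← diag_sign_mul_diag_abs_inv b hfin]
    exact hNw.mul_left ha _
  have hdiff := diag_inv_sub_diag_inv hrel hfin hfin'
  rw [← hG, ← hG'] at hdiff
  have hP : ∀ {r : ℝ}, 0 ≤ r → WeakClass r (basisProj b {i | l i = 0}) := fun hr =>
    weakClass_basisProj_of_finite b hr (finite_zeros hfin)
  have hP' : ∀ {r : ℝ}, 0 ≤ r → WeakClass r (basisProj b' {j | m j = 0}) := fun hr =>
    weakClass_basisProj_of_finite b' hr (finite_zeros hfin')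
  -- The resolvent identity is used twice: here crudely, to give `G'` the order of `G`, and then
  -- with both factors of `G' M G` to reach the order `2a`.
  have hG'w : WeakClass a G' := by
    rw [← sub_add_cancel G' G, hdiff]
    exact ((((hP ha).mul_left ha _).sub ha ((hP' ha).mul_right ha _)).sub ha
      (hGw.mul_left ha _)).add ha hGw
  have hdw : WeakClass (a + a) (G' - G) := by
    rw [hdiff]
    exact (((hP haa).mul_left haa _).sub haa ((hP' haa).mul_right haa _)).sub haa
      ((hG'w.mul_right ha M).mul ha ha hGw)
  have hsign : WeakClass (a + a) ((F' - F) * G) := by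
    rw [hF', hF, hG, diag_sign_sub_mul hfin]
    exact (((weakClass_basisProj_mul_diag ha hrel hfin hg).smul _).add haa
      ((weakClass_basisProj_mul_diag' ha hrel hfin hg).smul _)).sub haa
      ((hP' haa).mul_right haa _)
  have heq : diag b' (fun j => |m j|⁻¹) - N = F' * (G' - G) + (F' - F) * G := by
    rw [hN, ← diag_sign_mul_diag_inv b hfin, ← diag_sign_mul_diag_inv b' hfin']
    noncomm_ring
  rw [heq]
  exact (hdw.mul_left haa _).add haa hsign

theorem WeakClass.pow {a : ℝ} (ha : 0 ≤ a) {T : H →L[ℂ] H} (hT : WeakClass a T) (n : ℕ) :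
    WeakClass (n * a) (T ^ n) := by
  induction n with
  | zero => simpa using weakClass_zero _
  | succ n ih =>
    rw [pow_succ, Nat.cast_succ, add_one_mul]
    exact ih.mul (by positivity) ha hT

theorem WeakClass.pow_sub_pow {a : ℝ} (ha : 0 ≤ a) {S T : H →L[ℂ] H} (hS : WeakClass a S)
    (hT : WeakClass a T) (hST : WeakClass (a + a) (S - T)) (n : ℕ) :
    WeakClass (n * a + a) (S ^ n - T ^ n) := by
  induction n with
  | zero =>
    simp only [pow_zero, sub_self]
    exact weakClass_of_rank_lt (k := 0) (by positivity) (by simp)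
  | succ n ih =>
    -- Each telescoped term has one difference of order `2a` and `n` factors of order `a`.
    have heq : S ^ (n + 1) - T ^ (n + 1) = S ^ n * (S - T) + (S ^ n - T ^ n) * T := by
      rw [pow_succ, pow_succ]
      noncomm_ring
    have hexp : ((n + 1 : ℕ) : ℝ) * a + a = n * a + (a + a) := by push_cast; ring
    rw [heq, hexp]
    refine WeakClass.add (by positivity) ((hS.pow ha n).mul (by positivity) (by positivity) hST) ?_
    rw [← add_assoc]
    exact ih.mul (by positivity) ha hT

end Perturbation

/-! ### Eigenbases of symmetric operators with compact resolvent -/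

section Eigenbasis

variable {H : Type*} [NormedAddCommGroup H] [InnerProductSpace ℂ H] [CompleteSpace H]
variable {D : H →ₗ.[ℂ] H} {z : ℂ} {R R' : H →L[ℂ] H}

/-- `D` is symmetric on its domain. -/
def IsSymmetricOp (D : H →ₗ.[ℂ] H) : Prop :=
  ∀ x y : D.domain, inner ℂ (D x) (y : H) = inner ℂ (x : H) (D y)

theorem isSymmetricOp_of_isSelfAdjoint (hD : IsSelfAdjoint D) : IsSymmetricOp D := by
  have h := LinearPMap.adjoint_isFormalAdjoint hD.dense_domain
  rw [LinearPMap.isSelfAdjoint_def.mp hD] at h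
  exact fun x y => h x y

/-- `D` has compact resolvents at some point of the imaginary axis and at its conjugate. -/
def HasCompactResolventPair (D : H →ₗ.[ℂ] H) : Prop :=
  ∃ z : ℂ, z.re = 0 ∧ z.im ≠ 0 ∧ ∃ R R' : H →L[ℂ] H, IsResolvent D z R ∧
    IsResolvent D (-z) R' ∧ IsCompactOperator R ∧ IsCompactOperator R'

theorem mem_eigenspace_iff {t : ℝ} {x : H} :
    x ∈ eigenspace D t ↔ ∃ h : x ∈ D.domain, D ⟨x, h⟩ = (t : ℂ) • x := by
  change (x, (t : ℂ) • x) ∈ D.graph ↔ _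
  rw [LinearPMap.mem_graph_iff]
  constructor
  · rintro ⟨y, rfl, hy⟩
    exact ⟨y.2, hy⟩
  · rintro ⟨h, hx⟩
    exact ⟨⟨x, h⟩, rfl, hx⟩

theorem inner_eq_zero_of_mem_eigenspace (hs : IsSymmetricOp D) {s t : ℝ} (hst : s ≠ t) {x y : H}
    (hx : x ∈ eigenspace D s) (hy : y ∈ eigenspace D t) : inner ℂ x y = (0 : ℂ) := by
  obtain ⟨hx', hx⟩ := mem_eigenspace_iff.mp hx
  obtain ⟨hy', hy⟩ := mem_eigenspace_iff.mp hy
  have h := hs ⟨x, hx'⟩ ⟨y, hy'⟩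
  rw [hx, hy, inner_smul_left, inner_smul_right, Complex.conj_ofReal] at h
  by_contra h0
  exact hst (by exact_mod_cast mul_right_cancel₀ h0 h)

theorem IsResolvent.injective (hR : IsResolvent D z R) {x : H} (h : R x = 0) : x = 0 := by
  obtain ⟨hx, hDx⟩ := hR.1 x
  have h1 : (⟨R x, hx⟩ : D.domain) = 0 := Subtype.ext h
  rw [h1, h, LinearPMap.map_zero, smul_zero, sub_zero] at hDx
  exact hDx.symm

/-- For imaginary `z` the conjugate is `-z`, so the resolvents at `z` and `-z` are mutually adjoint.
-/
theorem IsResolvent.inner_left (hs : IsSymmetricOp D) (hz : z.re = 0) (hR : IsResolvent D z R)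
    (hR' : IsResolvent D (-z) R') (x y : H) : inner ℂ (R x) y = inner ℂ x (R' y) := by
  obtain ⟨hx, hDx⟩ := hR.1 x
  obtain ⟨hy, hDy⟩ := hR'.1 y
  have hconj : (starRingEnd ℂ) z = -z := by
    apply Complex.ext <;> simp [hz]
  have h := hs ⟨R x, hx⟩ ⟨R' y, hy⟩
  conv_lhs => rw [← hDy]
  conv_rhs => rw [← hDx]
  rw [inner_sub_right, inner_sub_left, inner_smul_left, inner_smul_right, hconj, h]

theorem IsResolvent.sub_eq {w : ℂ} (hR : IsResolvent D z R) (hR' : IsResolvent D w R') (x : H) :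
    R x - R' x = (z - w) • R (R' x) := by
  obtain ⟨hy, hDy⟩ := hR'.1 x
  have h := hR.2 ⟨R' x, hy⟩
  rw [sub_eq_iff_eq_add.mp hDy] at h
  have h1 : R (x + w • R' x - z • R' x) = R x + w • R (R' x) - z • R (R' x) := by
    simp only [map_add, map_sub, map_smul]
  change R (x + w • R' x - z • R' x) = R' x at h
  rw [h1, sub_eq_iff_eq_add] at h
  rw [sub_smul, sub_eq_sub_iff_add_eq_add, h, add_comm]

/-- For `x ≠ 0`, inverting gives `D x = (ρ⁻¹ + z) x`, and symmetry forces this eigenvalue to be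
real. -/
theorem mem_eigenspace_of_apply_eq_smul (hs : IsSymmetricOp D) (hR : IsResolvent D z R) {ρ : ℂ}
    {x : H} (hx : R x = ρ • x) : ∃ t : ℝ, x ∈ eigenspace D t := by
  rcases eq_or_ne x 0 with rfl | hx0
  · exact ⟨0, Submodule.zero_mem _⟩
  have hρ : ρ ≠ 0 := by
    rintro rfl
    exact hx0 (hR.injective (by rw [hx, zero_smul]))
  obtain ⟨hy, hDy⟩ := hR.1 x
  have hmem : x ∈ D.domain := by
    have h := D.domain.smul_mem ρ⁻¹ hy
    rwa [hx, smul_smul, inv_mul_cancel₀ hρ, one_smul] at h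
  have hDx : D ⟨x, hmem⟩ = (ρ⁻¹ + z) • x := by
    have h1 : (⟨R x, hy⟩ : D.domain) = ρ • ⟨x, hmem⟩ := Subtype.ext hx
    rw [h1, LinearPMap.map_smul, hx, sub_eq_iff_eq_add] at hDy
    have h2 := congrArg (ρ⁻¹ • ·) hDy
    simp only [smul_smul, smul_add, inv_mul_cancel₀ hρ, one_smul] at h2
    rw [h2, add_smul]
    congr 2
    field_simp
  have hreal : (starRingEnd ℂ) (ρ⁻¹ + z) = ρ⁻¹ + z := by
    have h := hs ⟨x, hmem⟩ ⟨x, hmem⟩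
    rw [hDx, inner_smul_left, inner_smul_right] at h
    exact mul_right_cancel₀ (inner_self_ne_zero.mpr hx0) h
  refine ⟨(ρ⁻¹ + z).re, mem_eigenspace_iff.mpr ⟨hmem, ?_⟩⟩
  rw [hDx, Complex.conj_eq_iff_re.mp hreal]

theorem IsResolvent.apply_of_mem_eigenspace (hz : z.im ≠ 0) (hR : IsResolvent D z R) {t : ℝ}
    {x : H} (hx : x ∈ eigenspace D t) : R x = ((t : ℂ) - z)⁻¹ • x := by
  obtain ⟨hx', hx⟩ := mem_eigenspace_iff.mp hx
  have h := hR.2 ⟨x, hx'⟩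
  rw [hx, ← sub_smul, map_smul] at h
  change ((t : ℂ) - z) • R x = x at h
  have h0 : (t : ℂ) - z ≠ 0 := fun h0 => hz (by simpa using congrArg Complex.im h0)
  rw [← h, smul_smul, h, inv_mul_cancel₀ h0, one_smul]

theorem finiteDimensional_eigenspace (hz : z.im ≠ 0) (hR : IsResolvent D z R)
    (hc : IsCompactOperator R) (t : ℝ) : FiniteDimensional ℂ (eigenspace D t) := by
  have h0 : (t : ℂ) - z ≠ 0 := fun h0 => hz (by simpa using congrArg Complex.im h0)
  have := ContinuousLinearMap.finite_dimensional_eigenspace hc _ (inv_ne_zero h0)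
  refine Submodule.finiteDimensional_of_le
    (S₂ := Module.End.eigenspace R.toLinearMap ((t : ℂ) - z)⁻¹) fun x hx => ?_
  exact Module.End.mem_eigenspace_iff.mpr (hR.apply_of_mem_eigenspace hz hx)

/-- The eigenvectors of a symmetric operator with compact resolvent span a dense subspace. -/
theorem eq_zero_of_forall_eigenspace (hs : IsSymmetricOp D) (hD : HasCompactResolventPair D)
    {v : H} (hv : ∀ t : ℝ, ∀ x ∈ eigenspace D t, inner ℂ x v = (0 : ℂ)) : v = 0 := by
  obtain ⟨z, hz, hz', R, R', hR, hR', hc, hc'⟩ := hD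
  have hadj := hR.inner_left hs hz hR'
  have hadj' : ∀ x y, inner ℂ (R' x) y = inner ℂ x (R y) := fun x y => by
    rw [← inner_conj_symm, ← hadj, inner_conj_symm]
  have hz2 : z - -z ≠ 0 := by
    rw [sub_neg_eq_add, ← two_mul]
    exact mul_ne_zero two_ne_zero fun h => hz' (by simp [h])
  have hcomm : ∀ x, R (R' x) = R' (R x) := fun x => by
    have h1 := hR.sub_eq hR' x
    have h2 := hR'.sub_eq hR x
    refine smul_right_injective H hz2 ?_
    change (z - -z) • R (R' x) = (z - -z) • R' (R x)
    rw [← h1, ← neg_sub (R' x), h2, ← neg_smul]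
    congr 1
    ring
  -- The normal operator `R` is diagonalised through two commuting self-adjoint operators: the
  -- compact `K`, and `A`, which acts on the finite-dimensional eigenspaces of `K`. The relation `2
  -- R = A + 2 z K` then recovers `R`.
  set K : H →L[ℂ] H := R ∘L R' with hK
  set A : H →L[ℂ] H := R + R' with hA
  have hKs : (K : H →ₗ[ℂ] H).IsSymmetric := fun x y => by
    change inner ℂ (R (R' x)) y = inner ℂ x (R (R' y))
    rw [hadj, hadj', hcomm]
  have hAs : (A : H →ₗ[ℂ] H).IsSymmetric := fun x y => by
    change inner ℂ (R x + R' x) y = inner ℂ x (R y + R' y)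
    rw [inner_add_left, inner_add_right, hadj, hadj', add_comm]
  have hKc : IsCompactOperator K := hc.comp_clm R'
  have hAK : ∀ x, A (K x) = K (A x) := fun x => by
    change R (R (R' x)) + R' (R (R' x)) = R (R' (R x + R' x))
    rw [map_add, map_add, ← hcomm x, ← hcomm (R' x)]
  have hRAK : ∀ x, (2 : ℂ) • R x = A x + (z - -z) • K x := fun x => by
    change _ = R x + R' x + (z - -z) • R (R' x)
    rw [← hR.sub_eq hR' x, two_smul]
    abel
  have hbot := ContinuousLinearMap.orthogonalComplement_iSup_eigenspaces_eq_bot hKc hKs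
  rw [← Submodule.iInf_orthogonal] at hbot
  rw [← Submodule.mem_bot ℂ, ← hbot, Submodule.mem_iInf]
  intro μ
  set E := Module.End.eigenspace (K : H →ₗ[ℂ] H) μ with hE
  -- The eigenvalue `0` does not occur, as both resolvents are injective.
  rcases eq_or_ne μ 0 with hμ | hμ
  · intro x hx
    have h1 : K x = 0 := by
      have h2 := Module.End.mem_eigenspace_iff.mp hx
      rwa [hμ, zero_smul] at h2
    rw [hR'.injective (hR.injective h1), inner_zero_left]
  have hfin : FiniteDimensional ℂ E :=
    ContinuousLinearMap.finite_dimensional_eigenspace hKc μ hμ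
  have hinv : ∀ x ∈ E, (A : H →ₗ[ℂ] H) x ∈ E := fun x hx => by
    have h1 : K x = μ • x := Module.End.mem_eigenspace_iff.mp hx
    refine Module.End.mem_eigenspace_iff.mpr ?_
    change K (A x) = μ • A x
    rw [← hAK, h1, map_smul]
  have hbotE := (hAs.restrict_invariant hinv).orthogonalComplement_iSup_eigenspaces_eq_bot
  rw [← Submodule.iInf_orthogonal] at hbotE
  have hproj : E.orthogonalProjectionOnto v = 0 := by
    rw [← Submodule.mem_bot ℂ, ← hbotE, Submodule.mem_iInf]
    intro α x hx
    rw [Submodule.inner_orthogonalProjectionOnto_eq_of_mem_left]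
    have h1 : K x = μ • (x : H) := Module.End.mem_eigenspace_iff.mp x.2
    have h2 : A x = α • (x : H) := congrArg Subtype.val (Module.End.mem_eigenspace_iff.mp hx)
    have h3 : R x = ((2 : ℂ)⁻¹ * (α + (z - -z) * μ)) • (x : H) := by
      have h4 := hRAK x
      rw [h1, h2, smul_smul, ← add_smul] at h4
      rw [← smul_smul, ← h4, smul_smul, inv_mul_cancel₀ two_ne_zero, one_smul]
    obtain ⟨t, ht⟩ := mem_eigenspace_of_apply_eq_smul hs hR h3
    exact hv t x ht
  exact Submodule.orthogonalProjectionOnto_eq_zero_iff.mp hproj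

/-- The vectors of the Hilbert basis `b` are eigenvectors of `D` with eigenvalues `l`. -/
def IsEigenbasis {ι : Type*} (D : H →ₗ.[ℂ] H) (b : HilbertBasis ι ℂ H) (l : ι → ℝ) : Prop :=
  ∀ i, b i ∈ eigenspace D (l i)

theorem exists_isEigenbasis (hs : IsSymmetricOp D) (hD : HasCompactResolventPair D) :
    ∃ (ι : Type) (b : HilbertBasis ι ℂ H) (l : ι → ℝ), IsEigenbasis D b l := by
  obtain ⟨z, -, hz', R, -, hR, -, hc, -⟩ := id hD
  have hfin := finiteDimensional_eigenspace hz' hR hc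
  let e : ∀ t : ℝ, OrthonormalBasis (Fin (Module.finrank ℂ (eigenspace D t))) ℂ (eigenspace D t) :=
    fun t => stdOrthonormalBasis ℂ (eigenspace D t)
  have hfam : OrthogonalFamily ℂ (fun t => eigenspace D t) fun t => (eigenspace D t).subtypeₗᵢ :=
    OrthogonalFamily.of_pairwise fun s t hst => by
      rw [Function.onFun, Submodule.isOrtho_iff_inner_eq]
      exact fun x hx y hy => inner_eq_zero_of_mem_eigenspace hs hst hx hy
  have horth := hfam.orthonormal_sigma_orthonormal (v_family := fun t => e t)
    fun t => (e t).orthonormal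
  have hspan : (Submodule.span ℂ (Set.range fun a : Σ t : ℝ,
      Fin (Module.finrank ℂ (eigenspace D t)) =>
        (eigenspace D a.1).subtypeₗᵢ (e a.1 a.2)))ᗮ = ⊥ := by
    rw [Submodule.eq_bot_iff]
    intro v hv
    refine eq_zero_of_forall_eigenspace hs hD fun t x hx => ?_
    have hle : ∀ y : eigenspace D t, inner ℂ (y : H) v = (0 : ℂ) := fun y => by
      rw [← (e t).sum_repr y, Submodule.coe_sum, sum_inner]
      refine Finset.sum_eq_zero fun i _ => ?_
      rw [Submodule.coe_smul, inner_smul_left]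
      have h1 : inner ℂ ((e t i : eigenspace D t) : H) v = (0 : ℂ) :=
        Submodule.inner_right_of_mem_orthogonal
          (Submodule.subset_span (Set.mem_range.mpr ⟨⟨t, i⟩, rfl⟩)) hv
      rw [h1, mul_zero]
    exact hle ⟨x, hx⟩
  refine ⟨_, HilbertBasis.mkOfOrthogonalEqBot horth hspan, fun a => a.1, fun a => ?_⟩
  rw [HilbertBasis.coe_mkOfOrthogonalEqBot]
  exact (e a.1 a.2).2

/-- The resolvent is bounded below on eigenvectors with `|l i| ≤ t`. Their images are uniformly
separated inside a totally bounded set, so there are finitely many. -/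
theorem IsEigenbasis.finite_abs_le {ι : Type*} {b : HilbertBasis ι ℂ H} {l : ι → ℝ}
    (hb : IsEigenbasis D b l) (hD : HasCompactResolventPair D) (t : ℝ) :
    {i | |l i| ≤ t}.Finite := by
  obtain ⟨z, -, hz', R, -, hR, -, hc, -⟩ := hD
  have hRb : ∀ i, R (b i) = ((l i : ℂ) - z)⁻¹ • b i := fun i =>
    hR.apply_of_mem_eigenspace hz' (hb i)
  have hz0 : 0 < ‖z‖ := norm_pos_iff.mpr fun h => hz' (by simp [h])
  have hlow : ∀ i ∈ {i | |l i| ≤ t}, (|t| + ‖z‖)⁻¹ ≤ ‖((l i : ℂ) - z)⁻¹‖ := fun i hi => by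
    have h0 : (l i : ℂ) - z ≠ 0 := fun h0 => hz' (by simpa using congrArg Complex.im h0)
    rw [norm_inv]
    refine inv_anti₀ (norm_pos_iff.mpr h0) ((norm_sub_le _ _).trans ?_)
    rw [Complex.norm_real, Real.norm_eq_abs]
    have h1 : |l i| ≤ t := hi
    linarith [le_abs_self t]
  set c := (|t| + ‖z‖)⁻¹ with hcdef
  have hc0 : 0 < c := by positivity
  have hsep : ∀ i ∈ {i | |l i| ≤ t}, ∀ j, i ≠ j → c ≤ ‖R (b i) - R (b j)‖ := fun i hi j hij => by
    have h1 : inner ℂ (b i) (R (b i) - R (b j)) = ((l i : ℂ) - z)⁻¹ := by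
      rw [hRb, hRb, inner_sub_right, inner_smul_right, inner_smul_right, inner_basis_eq b hij,
        inner_self_eq_norm_sq_to_K, b.orthonormal.1 i]
      simp
    have h2 := norm_inner_le_norm (𝕜 := ℂ) (b i) (R (b i) - R (b j))
    rw [h1, b.orthonormal.1 i, one_mul] at h2
    exact (hlow i hi).trans h2
  have htb : TotallyBounded (R '' Metric.closedBall 0 1) :=
    (hc.isCompact_closure_image_closedBall 1).totallyBounded.subset subset_closure
  obtain ⟨s, hs, hcover⟩ := Metric.totallyBounded_iff.mp htb (c / 2) (by positivity)
  have hex : ∀ i, ∃ y ∈ s, dist (R (b i)) y < c / 2 := fun i => by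
    have h1 := hcover ⟨b i, by simp [b.orthonormal.1 i], rfl⟩
    simpa using h1
  choose y hys hy using hex
  refine Set.Finite.of_finite_image (f := y) (hs.subset ?_) ?_
  · rintro _ ⟨i, -, rfl⟩
    exact hys i
  · intro i hi j _ hij
    by_contra hne
    have h1 := hsep i hi j hne
    rw [← dist_eq_norm] at h1
    have h2 := dist_triangle_right (R (b i)) (R (b j)) (y i)
    have h3 := hy i
    have h4 := hy j
    rw [← hij] at h4
    linarith

theorem IsSymmetricOp.perturb (hs : IsSymmetricOp D) {M : H →L[ℂ] H} (hM : IsSelfAdjoint M) :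
    IsSymmetricOp (perturb D M) := fun x y => by
  change inner ℂ (M (x : H) + D x) (y : H) = inner ℂ (x : H) (M (y : H) + D y)
  rw [inner_add_left, inner_add_right, hs x y]
  congr 1
  exact hM.isSymmetric (x : H) (y : H)

/-- Since `⟨R x, D R x⟩` is real, the imaginary part of `⟨R x, x⟩` is `-(Im z) ‖R x‖²`; apply
Cauchy–Schwarz. -/
theorem IsResolvent.norm_le (hs : IsSymmetricOp D) (hz : z.im ≠ 0) (hR : IsResolvent D z R) :
    ‖R‖ ≤ |z.im|⁻¹ := by
  refine ContinuousLinearMap.opNorm_le_bound _ (by positivity) fun x => ?_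
  obtain ⟨hx, hDx⟩ := hR.1 x
  have h1 : (inner ℂ (R x) x).im = -(z.im * ‖R x‖ ^ 2) := by
    have hreal : (inner ℂ (R x) (D ⟨R x, hx⟩)).im = 0 := by
      rw [← Complex.conj_eq_iff_im, inner_conj_symm]
      exact hs ⟨R x, hx⟩ ⟨R x, hx⟩
    rw [sub_eq_iff_eq_add] at hDx
    rw [show inner ℂ (R x) x = inner ℂ (R x) (D ⟨R x, hx⟩ - z • R x) by
      rw [hDx, add_sub_cancel_right], inner_sub_right, Complex.sub_im, hreal, inner_smul_right, inner_self_eq_norm_sq_to_K]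
    simp [← Complex.ofReal_pow]
  have h2 : |z.im| * ‖R x‖ ^ 2 ≤ ‖R x‖ * ‖x‖ := by
    have h3 := (Complex.abs_im_le_norm _).trans (norm_inner_le_norm (𝕜 := ℂ) (R x) x)
    rwa [h1, abs_neg, abs_mul, abs_of_nonneg (sq_nonneg ‖R x‖)] at h3
  rw [inv_mul_eq_div, le_div_iff₀ (abs_pos.mpr hz)]
  rcases (norm_nonneg (R x)).eq_or_lt with h | h
  · rw [← h, zero_mul]
    exact norm_nonneg x
  · refine le_of_mul_le_mul_left ?_ h
    linarith

theorem IsResolvent.exists_perturb (hs : IsSymmetricOp D) (hz : z.im ≠ 0)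
    (hR : IsResolvent D z R) (hc : IsCompactOperator R) {M : H →L[ℂ] H} (hM : ‖M‖ < |z.im|) :
    ∃ R' : H →L[ℂ] H, IsResolvent (perturb D M) z R' ∧ IsCompactOperator R' := by
  have hnorm : ‖-(M * R)‖ < 1 := by
    rw [norm_neg]
    refine (norm_mul_le _ _).trans_lt ?_
    refine (mul_le_mul_of_nonneg_left (hR.norm_le hs hz) (norm_nonneg _)).trans_lt ?_
    rwa [← div_eq_mul_inv, div_lt_one (abs_pos.mpr hz)]
  -- From `D + M - z = (1 + M R)(D - z)`, the perturbed resolvent is `R (1 + M R)⁻¹`, by a Neumann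
  -- series.
  obtain ⟨U, hU⟩ := isUnit_one_sub_of_norm_lt_one hnorm
  set S : H →L[ℂ] H := ((U⁻¹ : (H →L[ℂ] H)ˣ) : H →L[ℂ] H) with hS
  have hUx : ∀ x, (U : H →L[ℂ] H) x = x + M (R x) := fun x => by
    rw [hU, sub_neg_eq_add]
    rfl
  have hUS : ∀ x, S x + M (R (S x)) = x := fun x => by
    rw [← hUx]
    exact congrArg (fun T : H →L[ℂ] H => T x) U.mul_inv
  have hSU : ∀ x, S (x + M (R x)) = x := fun x => by
    rw [← hUx]
    exact congrArg (fun T : H →L[ℂ] H => T x) U.inv_mul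
  refine ⟨R * S, ⟨fun y => ?_, fun x => ?_⟩, hc.comp_clm S⟩
  · obtain ⟨hx, hDx⟩ := hR.1 (S y)
    refine ⟨hx, ?_⟩
    change M (R (S y)) + D ⟨R (S y), hx⟩ - z • R (S y) = y
    rw [add_sub_assoc, hDx, add_comm, hUS]
  · have h1 := hR.2 x
    change R (S (M (x : H) + D x - z • (x : H))) = x
    have h2 : M (x : H) + D x - z • (x : H) =
        (D x - z • (x : H)) + M (R (D x - z • (x : H))) := by
      rw [h1]
      abel
    rw [h2, hSU, h1]

theorem HasCompactResolvent.perturb (hs : IsSymmetricOp D) (hD : HasCompactResolvent D)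
    (M : H →L[ℂ] H) : HasCompactResolventPair (perturb D M) := by
  -- Far enough up the imaginary axis for the Neumann series to converge at `z` and at `-z`.
  set z : ℂ := ((‖M‖ + 1 : ℝ) : ℂ) * Complex.I with hz
  have him : z.im = ‖M‖ + 1 := by simp [hz]
  have hpos : 0 < ‖M‖ + 1 := by positivity
  have hz0 : z.im ≠ 0 := by rw [him]; exact hpos.ne'
  have hz0' : (-z).im ≠ 0 := by simpa using hz0
  have habs : ‖M‖ < |z.im| := by rw [him, abs_of_pos hpos]; linarith
  obtain ⟨R, hR, hc⟩ := hD z hz0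
  obtain ⟨R', hR', hc'⟩ := hD (-z) hz0'
  obtain ⟨S, hS, hSc⟩ := hR.exists_perturb hs hz0 hc habs
  obtain ⟨S', hS', hSc'⟩ := hR'.exists_perturb hs hz0' hc' (by simpa using habs)
  exact ⟨z, by simp [hz], hz0, S, S', hS, hS', hSc, hSc'⟩

theorem HasCompactResolvent.pair (hD : HasCompactResolvent D) : HasCompactResolventPair D := by
  obtain ⟨R, hR, hc⟩ := hD Complex.I (by simp)
  obtain ⟨R', hR', hc'⟩ := hD (-Complex.I) (by simp)
  exact ⟨Complex.I, by simp, by simp, R, R', hR, hR', hc, hc'⟩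

theorem IsEigenbasis.intertwines (hs : IsSymmetricOp D) {M : H →L[ℂ] H} (hM : IsSelfAdjoint M)
    {ι κ : Type*} {b : HilbertBasis ι ℂ H} {b' : HilbertBasis κ ℂ H} {l : ι → ℝ} {m : κ → ℝ}
    (hb : IsEigenbasis D b l) (hb' : IsEigenbasis (SpectralTriple.perturb D M) b' m) :
    Intertwines b b' l m M := fun i j => by
  obtain ⟨hi, hDi⟩ := mem_eigenspace_iff.mp (hb i)
  obtain ⟨hj, hDj⟩ := mem_eigenspace_iff.mp (hb' j)
  have h := hs.perturb hM ⟨b' j, hj⟩ ⟨b i, hi⟩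
  rw [hDj, inner_smul_left, Complex.conj_ofReal] at h
  change _ = inner ℂ (b' j) (M (b i) + D ⟨b i, hi⟩) at h
  rw [hDi, inner_add_right, inner_smul_right] at h
  rw [sub_mul, h]
  ring

end Eigenbasis

/-! ### Functional calculus and eigenvalue growth in an eigenbasis -/

section FunctionalCalculus

variable {H : Type*} [NormedAddCommGroup H] [InnerProductSpace ℂ H] [CompleteSpace H]
variable {D : H →ₗ.[ℂ] H} {ι : Type*} {b : HilbertBasis ι ℂ H} {l : ι → ℝ}

theorem spectralProj_eq (hs : IsSymmetricOp D) (hb : IsEigenbasis D b l) (t : ℝ) :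
    spectralProj D t = basisProj b {i | l i = t} := by
  refine clm_ext_basis b fun i => ?_
  rw [basisProj, diag_apply b (bddFun_indicator_one _), spectralProj]
  by_cases hi : l i = t
  · rw [Submodule.starProjection_eq_self_iff.mpr]
    · simp [hi]
    · exact Submodule.le_topologicalClosure _ (hi ▸ hb i)
  · rw [(Submodule.starProjection_apply_eq_zero_iff _).mpr]
    · simp [hi]
    · rw [Submodule.orthogonal_closure]
      exact fun x hx => inner_eq_zero_of_mem_eigenspace hs (Ne.symm hi) hx (hb i)

theorem bddFun_of_tendsto_cofinite {f : ι → ℝ} (hf : Filter.Tendsto f Filter.cofinite (𝓝 0)) :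
    BddFun f := by
  have h1 : {i | ¬ |f i| < 1}.Finite := by
    have h2 := Metric.tendsto_nhds.mp hf 1 one_pos
    simpa [Filter.eventually_cofinite] using h2
  obtain ⟨C, hC⟩ := bddFun_indicator_finite h1 f
  refine ⟨max C 1, fun i => ?_⟩
  by_cases hi : |f i| < 1
  · exact hi.le.trans (le_max_right _ _)
  · have h3 := hC i
    rw [Set.indicator_of_mem (show i ∈ {i | ¬ |f i| < 1} from hi)] at h3
    exact h3.trans (le_max_left _ _)

/-- Outside a finite set of eigenvalues the entries `f (l i)` are below `ε / 2`, and the norm of a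
diagonal operator is controlled by its entries. The spectral sum therefore converges in norm. -/
theorem funcCalcBdd_eq (hs : IsSymmetricOp D) (hb : IsEigenbasis D b l) {f : ℝ → ℝ}
    (hf : Filter.Tendsto (fun i => f (l i)) Filter.cofinite (𝓝 0)) :
    funcCalcBdd D f = diag b fun i => f (l i) := by
  classical
  have hbdd := bddFun_of_tendsto_cofinite hf
  refine HasSum.tsum_eq ?_
  have hpartial : ∀ s : Finset ℝ, ∑ t ∈ s, (f t : ℂ) • spectralProj D t =
      diag b ({i | l i ∈ s}.indicator fun i => f (l i)) := fun s => by
    refine clm_ext_basis b fun i => ?_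
    rw [diag_apply b (hbdd.indicator _), _root_.sum_apply]
    have h1 : ∀ t ∈ s, ((f t : ℂ) • spectralProj D t) (b i) =
        if t = l i then (f (l i) : ℂ) • b i else 0 := fun t _ => by
      rw [_root_.smul_apply, spectralProj_eq hs hb, basisProj,
        diag_apply b (bddFun_indicator_one _)]
      by_cases ht : t = l i
      · simp [ht]
      · simp [ht, Ne.symm ht]
    rw [Finset.sum_congr rfl h1, Finset.sum_ite_eq' s (l i)]
    by_cases hi : l i ∈ s <;> simp [hi]
  rw [HasSum, SummationFilter.unconditional_filter, Metric.tendsto_atTop]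
  intro ε hε
  have hfin : {i | ¬ |f (l i)| < ε / 2}.Finite := by
    have h2 := Metric.tendsto_nhds.mp hf (ε / 2) (by positivity)
    simpa [Filter.eventually_cofinite] using h2
  refine ⟨(hfin.image l).toFinset, fun s hsub => ?_⟩
  rw [hpartial, dist_comm, dist_eq_norm]
  have hsplit : diag b (fun i => f (l i)) - diag b ({i | l i ∈ s}.indicator fun i => f (l i)) =
      diag b ({i | l i ∈ s}ᶜ.indicator fun i => f (l i)) := by
    rw [sub_eq_iff_eq_add, diag_add b (hbdd.indicator _) (hbdd.indicator _),
      Set.indicator_compl_add_self]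
  rw [hsplit]
  refine (norm_diag_le b (C := ε / 2) (by positivity) fun i => ?_).trans_lt (half_lt_self hε)
  by_cases hi : l i ∈ s
  · simp only [Set.mem_compl_iff, Set.mem_ofPred_eq, hi, not_true_eq_false, not_false_eq_true,
      Set.indicator_of_notMem, abs_zero]
    positivity
  · rw [Set.indicator_of_mem (show i ∈ {i | l i ∈ s}ᶜ from hi)]
    by_contra h
    refine hi (hsub ?_)
    rw [Set.Finite.mem_toFinset]
    exact ⟨i, fun h' => h h'.le, rfl⟩

theorem tendsto_abs_cofinite (hfin : ∀ t : ℝ, {i | |l i| ≤ t}.Finite) :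
    Filter.Tendsto (fun i => |l i|) Filter.cofinite Filter.atTop := by
  refine Filter.tendsto_atTop.mpr fun t => ?_
  rw [Filter.eventually_cofinite]
  exact (hfin t).subset fun i hi => (not_le.mp hi).le

theorem absInvPow_eq (hs : IsSymmetricOp D) (hb : IsEigenbasis D b l)
    (hfin : ∀ t : ℝ, {i | |l i| ≤ t}.Finite) {p : ℕ} (hp : 1 ≤ p) :
    absInvPow D p = (diag b fun i => |l i|⁻¹) ^ p := by
  have hlim : Filter.Tendsto (fun i => |l i|⁻¹ ^ p) Filter.cofinite (𝓝 0) := by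
    have h := ((tendsto_inv_atTop_zero.comp (tendsto_abs_cofinite hfin)).pow p)
    rwa [zero_pow (by lia)] at h
  rw [absInvPow, funcCalcBdd_eq hs hb hlim]
  have hb' := bddFun_abs_inv hfin
  refine clm_ext_basis b fun i => ?_
  rw [diag_apply b (bddFun_of_tendsto_cofinite hlim)]
  have hpow : ∀ n : ℕ, ((diag b fun i => |l i|⁻¹) ^ n) (b i) = ((|l i|⁻¹ ^ n : ℝ) : ℂ) • b i := by
    intro n
    induction n with
    | zero => simp
    | succ n ih =>
      rw [pow_succ]
      change ((diag b fun i => |l i|⁻¹) ^ n) (diag b (fun i => |l i|⁻¹) (b i)) = _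
      rw [diag_apply b hb', map_smul, ih, smul_smul, pow_succ, Complex.ofReal_mul, mul_comm]
  exact (hpow p).symm

theorem le_singularValue_diag {f : ι → ℝ} (hf : BddFun f) (hf0 : ∀ i, 0 ≤ f i) {u : Finset ι}
    {k : ℕ} (hu : k < u.card) {q : ℝ} (hq : ∀ i ∈ u, q ≤ f i) :
    q ≤ singularValue (diag b f) k := by
  set V : Submodule ℂ H := Submodule.span ℂ (Set.range fun i : u => b i)
  have hlin : LinearIndependent ℂ fun i : u => b i :=
    (b.orthonormal.comp _ Subtype.val_injective).linearIndependent
  have hV : FiniteDimensional ℂ V := FiniteDimensional.span_of_finite ℂ (Set.finite_range _)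
  have hrank : Module.finrank ℂ V = u.card := by
    simpa using finrank_span_eq_card hlin
  refine le_singularValue_of_subspace (V := V) (hrank ▸ hu) fun v hv => ?_
  have hproj : basisProj b (u : Set ι) v = v := by
    have hle : V ≤ LinearMap.eqLocus (basisProj b (u : Set ι) : H →ₗ[ℂ] H) LinearMap.id := by
      refine Submodule.span_le.mpr ?_
      rintro _ ⟨i, rfl⟩
      change basisProj b (u : Set ι) (b i) = b i
      rw [basisProj, diag_apply b (bddFun_indicator_one _)]
      simp
    exact hle hv
  have h1 := hasSum_re_inner_diag b hf v
  have h2 := (hasSum_re_inner_diag b (bddFun_indicator_one (u : Set ι)) v).mul_left q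
  have h3 : q * ‖v‖ ^ 2 ≤ (inner ℂ v (diag b f v)).re := by
    have h4 := hasSum_le (fun i => ?_) h2 h1
    · change q * (inner ℂ v (basisProj b (u : Set ι) v)).re ≤ _ at h4
      rw [hproj, inner_self_eq_norm_sq_to_K] at h4
      simpa [← Complex.ofReal_pow] using h4
    · rw [← mul_assoc]
      refine mul_le_mul_of_nonneg_right ?_ (by positivity)
      by_cases hi : i ∈ u
      · simpa [hi] using hq i hi
      · simpa [hi] using hf0 i
  have h5 : (inner ℂ v (diag b f v)).re ≤ ‖v‖ * ‖diag b f v‖ :=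
    (Complex.re_le_norm _).trans (norm_inner_le_norm _ _)
  rcases (norm_nonneg v).eq_or_lt with h | h
  · rw [← h, mul_zero]
    exact norm_nonneg _
  · refine le_of_mul_le_mul_left ?_ h
    linarith

/-- If more than `k` eigenvalues had `|l i| < c X`, with `X = (k + 1) ^ a`, min-max would give
`s_k((D² + 1)⁻¹) ≥ (c² X² + 1)⁻¹`. This exceeds the assumed `C' X⁻²` for suitable `c` and large `k`.
-/
theorem eigenvalueGrowth_of_hasMetricDimension (hs : IsSymmetricOp D) (hb : IsEigenbasis D b l)
    (hfin : ∀ t : ℝ, {i | |l i| ≤ t}.Finite) {p : ℕ} (hp : 1 ≤ p)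
    (hdim : HasMetricDimension D p) : EigenvalueGrowth l (1 / (p : ℝ)) := by
  have hp0 : (0 : ℝ) < p := by exact_mod_cast hp
  have hlim : Filter.Tendsto (fun i => (l i ^ 2 + 1)⁻¹) Filter.cofinite (𝓝 0) := by
    refine tendsto_inv_atTop_zero.comp (Filter.tendsto_atTop_add_const_right _ _ ?_)
    have h := (Filter.tendsto_pow_atTop (α := ℝ) two_ne_zero).comp (tendsto_abs_cofinite hfin)
    simpa [Function.comp_def] using h
  rw [HasMetricDimension, funcCalcBdd_eq hs hb hlim, Asymptotics.isBigO_iff'] at hdim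
  obtain ⟨C, hC, hev⟩ := hdim
  set a : ℝ := 1 / (p : ℝ) with ha
  have ha0 : 0 < a := by positivity
  have hX : Filter.Tendsto (fun k : ℕ => ((k : ℝ) + 1) ^ a) Filter.atTop Filter.atTop :=
    (tendsto_rpow_atTop ha0).comp
      (Filter.tendsto_atTop_add_const_right _ _ tendsto_natCast_atTop_atTop)
  -- The factor `2 ^ (2 * a)` pays for replacing `k` by `k + 1`, since `k + 1 ≤ 2 k`.
  set C' : ℝ := C * 2 ^ (2 * a) with hC'
  have hC'0 : 0 < C' := by positivity
  obtain ⟨k₀, hk₀⟩ := Filter.eventually_atTop.mp (hev.and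
    ((hX.eventually_gt_atTop (2 * C' + 1)).and (Filter.eventually_ge_atTop 1)))
  -- With `c² = 1 / (2 C')` the comparison reads `X² ≤ X² / 2 + C'`, which `X > 2 C' + 1`
  -- contradicts.
  set c : ℝ := (Real.sqrt (2 * C'))⁻¹ with hc
  have hc0 : 0 < c := by positivity
  have hc2 : c ^ 2 = (2 * C')⁻¹ := by rw [hc, inv_pow, Real.sq_sqrt (by positivity)]
  refine ⟨c, hc0, k₀, fun k hk => ?_⟩
  obtain ⟨hsv, hbig, hk1⟩ := hk₀ k hk
  set X : ℝ := ((k : ℝ) + 1) ^ a with hXdef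
  have hX0 : 0 < X := by positivity
  have hfs : {i | |l i| < c * X}.Finite := (hfin (c * X)).subset fun i (hi : |l i| < c * X) => hi.le
  refine ⟨hfs.toFinset, ?_, fun i hi => by simpa using hi⟩
  by_contra! hcard
  have hq := le_singularValue_diag (b := b) (bddFun_of_tendsto_cofinite hlim)
    (fun i => by positivity) hcard (q := (c ^ 2 * X ^ 2 + 1)⁻¹) fun i hi => by
      have h1 : |l i| < c * X := by simpa using hi
      refine inv_anti₀ (by positivity) ?_
      have h2 : l i ^ 2 ≤ (c * X) ^ 2 := sq_le_sq' (by linarith [neg_abs_le (l i)])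
        ((le_abs_self _).trans h1.le)
      rw [mul_pow] at h2
      linarith
  have hk0 : (0 : ℝ) < k := by exact_mod_cast hk1
  have hsv' : singularValue (diag b fun i => (l i ^ 2 + 1)⁻¹) k ≤ C' * (X ^ 2)⁻¹ := by
    rw [Real.norm_of_nonneg (singularValue_nonneg _ _), Real.norm_of_nonneg (by positivity)] at hsv
    refine hsv.trans ?_
    rw [hC', mul_assoc]
    refine mul_le_mul_of_nonneg_left ?_ hC.le
    have h1 : X ^ 2 = ((k : ℝ) + 1) ^ (2 * a) := by
      rw [hXdef, ← Real.rpow_natCast, ← Real.rpow_mul (by positivity)]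
      congr 1
      push_cast
      ring
    have h2 : 2 / (p : ℝ) = 2 * a := by rw [ha]; ring
    have h3 : ((k : ℝ) + 1) ^ (2 * a) ≤ 2 ^ (2 * a) * (k : ℝ) ^ (2 * a) := by
      rw [← Real.mul_rpow (by norm_num) hk0.le]
      have : (1 : ℝ) ≤ k := by exact_mod_cast hk1
      exact Real.rpow_le_rpow (by positivity) (by linarith) (by positivity)
    rw [h1, h2, Real.rpow_neg hk0.le, ← div_eq_mul_inv, le_div_iff₀ (by positivity),
      inv_mul_le_iff₀ (by positivity)]
    exact h3.trans_eq (mul_comm _ _)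
  have hfinal := hq.trans hsv'
  rw [← div_eq_mul_inv, le_div_iff₀ (by positivity), inv_mul_le_iff₀ (by positivity), hc2] at hfinal
  have h1 : ((2 * C')⁻¹ * X ^ 2 + 1) * C' = X ^ 2 / 2 + C' := by
    field_simp
  rw [h1] at hfinal
  nlinarith

end FunctionalCalculus

end SpectralTriple

/-! ### The main theorem -/

open SpectralTriple

theorem mainTheorem8 {H : Type*} [NormedAddCommGroup H] [InnerProductSpace ℂ H] [CompleteSpace H]
    (𝒜 : StarSubalgebra ℝ (H →L[ℂ] H)) (D : H →ₗ.[ℂ] H) (p : ℕ) (hp : 1 ≤ p)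
    (hD : SpectralTriple.IsSpectralTriple 𝒜 D)
    (hreg : SpectralTriple.IsStronglyRegular 𝒜 D)
    (hdim : SpectralTriple.HasMetricDimension D p)
    (M : H →L[ℂ] H) (hM : IsSelfAdjoint M) (hMend : SpectralTriple.MemModuleEnd 𝒜 D M) :
    SpectralTriple.IsTraceClass
        (SpectralTriple.absInvPow (SpectralTriple.perturb D M) p - SpectralTriple.absInvPow D p) ∧
      ∀ T : H →L[ℂ] H,
        SpectralTriple.MemDixmierIdeal (T * SpectralTriple.absInvPow D p) ∧
        SpectralTriple.MemDixmierIdeal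
          (T * SpectralTriple.absInvPow (SpectralTriple.perturb D M) p) ∧
        ∀ ω : SpectralTriple.ExtendedLimit,
          SpectralTriple.dixmierTrace ω (T * SpectralTriple.absInvPow D p) =
            SpectralTriple.dixmierTrace ω
              (T * SpectralTriple.absInvPow (SpectralTriple.perturb D M) p) := by
  have hp0 : (0 : ℝ) < p := by exact_mod_cast hp
  have hs := isSymmetricOp_of_isSelfAdjoint hD.isSelfAdjoint
  have hs' := hs.perturb hM
  have hpair := hD.hasCompactResolvent.pair
  have hpair' := hD.hasCompactResolvent.perturb hs M
  obtain ⟨ι, b, l, hb⟩ := exists_isEigenbasis hs hpair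
  obtain ⟨κ, b', m, hb'⟩ := exists_isEigenbasis hs' hpair'
  have hfin := hb.finite_abs_le hpair
  have hfin' := hb'.finite_abs_le hpair'
  have hrel := hb.intertwines hs hM hb'
  set a : ℝ := 1 / (p : ℝ) with ha
  have ha0 : 0 < a := by positivity
  have hpa : (p : ℝ) * a = 1 := by rw [ha]; field_simp
  have hgrowth := eigenvalueGrowth_of_hasMetricDimension hs hb hfin hp hdim
  have hN : WeakClass a (diag b fun i => |l i|⁻¹) := weakClass_diag_abs_inv ha0.le hfin hgrowth
  have hsub := weakClass_diag_abs_inv_sub ha0.le hrel hfin hfin' hgrowth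
  -- The decay of `|D_M|⁻¹` is inherited from that of `|D|⁻¹` and of the difference; no eigenvalue
  -- count for `D_M` is needed.
  have hN' : WeakClass a (diag b' fun j => |m j|⁻¹) := by
    rw [← sub_add_cancel (diag b' fun j => |m j|⁻¹) (diag b fun i => |l i|⁻¹)]
    exact (hsub.mono (by linarith)).add ha0.le hN
  have hdiff := hN'.pow_sub_pow ha0.le hN hsub p
  have hpow := hN.pow ha0.le p
  have hpow' := hN'.pow ha0.le p
  rw [hpa] at hdiff hpow hpow'
  rw [← absInvPow_eq hs hb hfin hp] at hdiff hpow
  rw [← absInvPow_eq hs' hb' hfin' hp] at hdiff hpow'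
  have h1a : 1 < 1 + a := by linarith
  refine ⟨hdiff.isTraceClass h1a, fun T => ?_⟩
  have hT := hpow.mul_left zero_le_one T
  have hT' := hpow'.mul_left zero_le_one T
  refine ⟨hT.memDixmierIdeal, hT'.memDixmierIdeal, fun ω => ?_⟩
  have heq : T * absInvPow (perturb D M) p =
      T * absInvPow D p + T * (absInvPow (perturb D M) p - absInvPow D p) := by
    rw [mul_sub, add_sub_cancel]
  rw [heq] at hT' ⊢
  exact (dixmierTrace_add_eq ω hT h1a (hdiff.mul_left (by linarith) T) hT').symm
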